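/- Let $\tau$ be in the upper half plane, let $\wp$ be the Weierstrass function with periods $(1,\tau)$, and put $\omega_0=0$, $\omega_1=\frac12$, $\omega_2=-\frac{\tau+1}{2}$, $\omega_3=\frac{\tau}{2}$. Let $l_0,l_1,l_2,l_3\in\mathbb Z_{\ge 0}$ be not all zero, $u(x)=\sum_{i=0}^3 l_i(l_i+1)\wp(x+\omega_i)$, and let $D\subset\mathbb C$ be the complement of the set of poles of $u$. Let $$\Xi(x,E)=c_0(E)+\sum_{i=0}^3\sum_{j=0}^{l_i-1}b^{(i)}_j(E)\,\wp(x+\omega_i)^{l_i-j}$$ be the normalized doubly periodic solution of $\Xi'''-4(u-E)\Xi'-2u'\,\Xi=0$ (for all $E$; $'=\partial/\partial x$), where the $c_0,b^{(i)}_j\in\mathbb C[E]$ have no common divisor and $c_0$ is monic. Put $$Q(E)=\Xi^2(E-u)+\tfrac12\,\Xi\,\Xi''-\tfrac14(\Xi')^2\quad(\text{which is independent of }x\in D),\qquad Q_1(E)=\int_{\varepsilon}^{1+\varepsilon}\Xi(x,E)\,dx,$$ where $\varepsilon\in\mathbb C$ is such that $\varepsilon+\mathbb R\subset D$ and the integral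 is taken along the horizontal segment. Let $U\subseteq D$ be a connected open set with $U+1\subseteq U$ that contains a horizontal line $a+\mathbb R$ (for example $U=D$). For $E\in\mathbb C$ and a value $s$ of $\sqrt{-Q(E)}$, denote by $$\Lambda(x,E)=\sqrt{\Xi(x,E)}\,\exp\int\frac{\sqrt{-Q(E)}}{\Xi(x,E)}\,dx$$ any holomorphic function on $U$ that near each point of $U$ with $\Xi(x,E)\ne0$ has the form $r\,e^{F}$, with $r$ holomorphic, $r^2=\Xi(\cdot,E)$ and $F'=s/\Xi(\cdot,E)$. Let $Q(E_0)=0$. Then either $\Lambda(x+1,E_0)=\Lambda(x,E_0)$ for all $x\in U$, or $\Lambda(x+1,E_0)=-\Lambda(x,E_0)$ for all $x\in U$. Let $E_*\in\mathbb C$, let $\gamma:[0,1]\to\mathbb C$ be a continuous path from $E_0$ to $E_*$, continuously differentiable on $(0,1)$ and with $Q(\gamma(t))\neq0$ for $0<t<1$, and let $\sqrt{-Q}$ be a continuous branch of the square root along $\gamma$. Then the integral $\int_{E_0}^{E_*}\frac{Q_1(E)}{\sqrt{-Q(E)}}\,dE$ along $\gamma$ converges (as an improper integral at both ends), and, if the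 value of $\sqrt{-Q(E_*)}$ in $\Lambda(x,E_*)$ is that of the branch at the end of $\gamma$, then for all $x\in U$ $$\Lambda(x+1,E_*)=\Lambda(x,E_*)\exp\left(-\frac12\int_{E_0}^{E_*}\frac{Q_1(E)}{\sqrt{-Q(E)}}\,dE\right)\quad\text{if }\Lambda(x+1,E_0)=\Lambda(x,E_0)\ (x\in U),$$ $$\Lambda(x+1,E_*)=-\Lambda(x,E_*)\exp\left(-\frac12\int_{E_0}^{E_*}\frac{Q_1(E)}{\sqrt{-Q(E)}}\,dE\right)\quad\text{if }\Lambda(x+1,E_0)=-\Lambda(x,E_0)\ (x\in U).$$ -/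

import Mathlib

open Filter Topology Polynomial

noncomputable section

namespace Inozemtsev

/-- The pair of periods `(1, τ)` with `τ` in the upper half plane. -/
def periods (τ : UpperHalfPlane) : PeriodPair where
  ω₁ := 1
  ω₂ := (τ : ℂ)
  indep := by
    rw [LinearIndependent.pair_iff]
    intro s t h
    have him := congrArg Complex.im h
    have hre := congrArg Complex.re h
    simp only [Complex.add_im, Complex.add_re, Complex.smul_im, Complex.smul_re, Complex.one_im,
      Complex.one_re, Complex.zero_im, Complex.zero_re, smul_eq_mul, mul_zero, zero_add,
      mul_one] at him hre
    have ht : t = 0 := by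
      rcases mul_eq_zero.mp him with h0 | h0
      · exact h0
      · exact absurd h0 τ.im_pos.ne'
    refine ⟨?_, ht⟩
    simpa [ht] using hre

/-- The half-periods `ω₀ = 0`, `ω₁ = 1/2`, `ω₂ = -(τ+1)/2`, `ω₃ = τ/2`. -/
def halfPeriod (τ : UpperHalfPlane) : Fin 4 → ℂ :=
  ![0, 1 / 2, -((τ : ℂ) + 1) / 2, (τ : ℂ) / 2]

/-- The function `x ↦ ℘(x + ω_i)`, where `℘` has periods `(1, τ)`. -/
def wp (τ : UpperHalfPlane) (i : Fin 4) (x : ℂ) : ℂ :=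
  (periods τ).weierstrassP (x + halfPeriod τ i)

/-- The function `x ↦ ℘'(x + ω_i)`. -/
def wpDeriv (τ : UpperHalfPlane) (i : Fin 4) (x : ℂ) : ℂ :=
  (periods τ).derivWeierstrassP (x + halfPeriod τ i)

/-- The potential `u(x) = ∑ l_i (l_i + 1) ℘(x + ω_i)`. -/
def potential (τ : UpperHalfPlane) (l : Fin 4 → ℕ) (x : ℂ) : ℂ :=
  ∑ i, ((l i : ℂ) * (l i + 1)) * wp τ i x

/-- The derivative `u'(x) = ∑ l_i (l_i + 1) ℘'(x + ω_i)` of the potential. -/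
def potentialDeriv (τ : UpperHalfPlane) (l : Fin 4 → ℕ) (x : ℂ) : ℂ :=
  ∑ i, ((l i : ℂ) * (l i + 1)) * wpDeriv τ i x

/-- The complex plane without the poles of the potential, which are the points of
`-ω_i + ℤ + ℤ τ` for those `i` with `l_i ≠ 0`. -/
def regularSet (τ : UpperHalfPlane) (l : Fin 4 → ℕ) : Set ℂ :=
  {x | ∀ i, l i ≠ 0 → x + halfPeriod τ i ∉ (periods τ).lattice}

/-- The coefficients of an expression
`c(E) + ∑_i ∑_{j < l_i} b_{i,j}(E) ℘(x + ω_i) ^ (l_i - j)`, polynomials in `E`. -/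
structure XiCoeffs (l : Fin 4 → ℕ) where
  c : ℂ[X]
  b : (i : Fin 4) → Fin (l i) → ℂ[X]

/-- The function `Ξ(x, E) = c(E) + ∑_i ∑_{j < l_i} b_{i,j}(E) ℘(x + ω_i) ^ (l_i - j)`. -/
def Xi (τ : UpperHalfPlane) {l : Fin 4 → ℕ} (ξ : XiCoeffs l) (x E : ℂ) : ℂ :=
  ξ.c.eval E + ∑ i, ∑ j : Fin (l i), (ξ.b i j).eval E * wp τ i x ^ (l i - (j : ℕ))

/-- The normalized doubly periodic solution of the equation satisfied by the products of two
solutions of `-f'' + u f = E f`: the function `Ξ(x, E)` solves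
`Ξ''' - 4 (u - E) Ξ' - 2 u' Ξ = 0` for every `E`, its coefficients have no common divisor in
`ℂ[E]`, and the coefficient `c` is monic. -/
structure IsXi (τ : UpperHalfPlane) {l : Fin 4 → ℕ} (ξ : XiCoeffs l) : Prop where
  monic : ξ.c.Monic
  coprime : ∀ p : ℂ[X], p ∣ ξ.c → (∀ i j, p ∣ ξ.b i j) → IsUnit p
  ode : ∀ E : ℂ, ∀ x ∈ regularSet τ l,
    iteratedDeriv 3 (fun z => Xi τ ξ z E) x
      - 4 * (potential τ l x - E) * deriv (fun z => Xi τ ξ z E) x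
      - 2 * potentialDeriv τ l x * Xi τ ξ x E = 0

/-- The expression `Ξ² (E - u) + (1/2) Ξ Ξ'' - (1/4) (Ξ')²`. -/
def QExpr (τ : UpperHalfPlane) {l : Fin 4 → ℕ} (ξ : XiCoeffs l) (x E : ℂ) : ℂ :=
  Xi τ ξ x E ^ 2 * (E - potential τ l x)
    + 1 / 2 * Xi τ ξ x E * iteratedDeriv 2 (fun z => Xi τ ξ z E) x
    - 1 / 4 * deriv (fun z => Xi τ ξ z E) x ^ 2

/-- `Q(E)`: the value of `Ξ² (E - u) + (1/2) Ξ Ξ'' - (1/4) (Ξ')²`, which does not depend on the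
point `x` of the regular set (see `QExpr_eq_Q`); here it is read off at `x = 1/4`, which is never
a pole. -/
def Q (τ : UpperHalfPlane) {l : Fin 4 → ℕ} (ξ : XiCoeffs l) (E : ℂ) : ℂ :=
  QExpr τ ξ (1 / 4) E

theorem quarter_mem_regularSet (τ : UpperHalfPlane) (l : Fin 4 → ℕ) :
    (1 / 4 : ℂ) ∈ regularSet τ l := by
  intro i _ h
  obtain ⟨m, n, hmn⟩ := PeriodPair.mem_lattice.mp h
  have hτ := τ.im_pos
  have key : ∀ a b : ℝ, ((m : ℂ) * 1 + (n : ℂ) * (τ : ℂ) = 1 / 4 + a + b * τ) →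
      (m : ℝ) = 1 / 4 + a := by
    intro a b h
    have him := congrArg Complex.im h
    have hre := congrArg Complex.re h
    simp at him hre
    have hnb : (n : ℝ) = b := by
      rcases him with h1 | h1
      · exact h1
      · exact absurd h1 hτ.ne'
    rw [hnb] at hre
    have h4 : ((4 : ℂ)⁻¹).re = 1 / 4 := by
      norm_num
    linarith
  have fin : ∀ k : ℤ, (m : ℝ) ≠ 1 / 4 + k / 2 := by
    intro k hk
    have : (4 * m : ℤ) = 1 + 2 * k := by
      have : (4 * (m : ℝ)) = 1 + 2 * k := by linarith
      exact_mod_cast this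
    omega
  change (m : ℂ) * 1 + (n : ℂ) * (τ : ℂ) = _ at hmn
  fin_cases i
  · exact fin 0 (by have := key 0 0 (by rw [hmn]; simp [halfPeriod]); rw [this]; norm_num)
  · exact fin 1 (by
      have := key (1 / 2) 0 (by rw [hmn]; simp [halfPeriod]); rw [this]; norm_num)
  · exact fin (-1) (by
      have := key (-1 / 2) (-1 / 2) (by rw [hmn]; simp [halfPeriod]; ring)
      rw [this]; norm_num)
  · exact fin 0 (by
      have := key 0 (1 / 2) (by rw [hmn]; simp [halfPeriod]; ring)
      rw [this]; norm_num)

theorem regularSet_eq (τ : UpperHalfPlane) (l : Fin 4 → ℕ) :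
    regularSet τ l =
      (⋃ i ∈ {i | l i ≠ 0}, (fun x => x + halfPeriod τ i) ⁻¹' ((periods τ).lattice : Set ℂ))ᶜ := by
  ext x
  simp [regularSet]

theorem isOpen_regularSet (τ : UpperHalfPlane) (l : Fin 4 → ℕ) : IsOpen (regularSet τ l) := by
  rw [regularSet_eq, isOpen_compl_iff]
  refine Set.Finite.isClosed_biUnion (Set.toFinite _) fun i _ => ?_
  exact (periods τ).isClosed_lattice.preimage (by fun_prop)

theorem isPreconnected_regularSet (τ : UpperHalfPlane) (l : Fin 4 → ℕ) :
    IsPreconnected (regularSet τ l) := by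
  rw [regularSet_eq]
  refine (Set.Countable.isConnected_compl_of_one_lt_rank (by simp) ?_).isPreconnected
  refine Set.Countable.biUnion (Set.to_countable _) fun i _ => ?_
  refine Set.Countable.preimage_of_injOn ?_ (add_left_injective _).injOn
  have : Countable (periods τ).lattice := (periods τ).latticeEquivProd.toEquiv.injective.countable
  exact Set.to_countable _

theorem analyticAt_wp {τ : UpperHalfPlane} {l : Fin 4 → ℕ} {x : ℂ} (hx : x ∈ regularSet τ l)
    {i : Fin 4} (hi : l i ≠ 0) : AnalyticAt ℂ (wp τ i) x :=
  ((periods τ).analyticOnNhd_weierstrassP _ (hx i hi)).comp_of_eq (by fun_prop) rfl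

theorem hasDerivAt_wp {τ : UpperHalfPlane} {l : Fin 4 → ℕ} {x : ℂ} (hx : x ∈ regularSet τ l)
    {i : Fin 4} (hi : l i ≠ 0) : HasDerivAt (wp τ i) (wpDeriv τ i x) x := by
  have h := ((periods τ).analyticOnNhd_weierstrassP _ (hx i hi)).differentiableAt.hasDerivAt
  rw [PeriodPair.deriv_weierstrassP] at h
  exact h.comp_add_const x _

theorem hasDerivAt_potential {τ : UpperHalfPlane} {l : Fin 4 → ℕ} {x : ℂ}
    (hx : x ∈ regularSet τ l) : HasDerivAt (potential τ l) (potentialDeriv τ l x) x := by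
  unfold potential potentialDeriv
  refine HasDerivAt.fun_sum fun i _ => ?_
  by_cases hi : l i = 0
  · simpa [hi] using hasDerivAt_const x (0 : ℂ)
  · exact (hasDerivAt_wp hx hi).const_mul _

theorem analyticAt_Xi {τ : UpperHalfPlane} {l : Fin 4 → ℕ} (ξ : XiCoeffs l) (E : ℂ) {x : ℂ}
    (hx : x ∈ regularSet τ l) : AnalyticAt ℂ (fun z => Xi τ ξ z E) x := by
  unfold Xi
  refine analyticAt_const.add (Finset.analyticAt_fun_sum _ fun i _ =>
    Finset.analyticAt_fun_sum _ fun j _ => analyticAt_const.mul ((analyticAt_wp hx ?_).pow _))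
  have := j.2
  omega

/-- The expression defining `Q` does not depend on the regular point `x`. -/
theorem QExpr_eq_Q {τ : UpperHalfPlane} {l : Fin 4 → ℕ} {ξ : XiCoeffs l} (hξ : IsXi τ ξ) {x : ℂ}
    (hx : x ∈ regularSet τ l) (E : ℂ) : QExpr τ ξ x E = Q τ ξ E := by
  have hd : ∀ z ∈ regularSet τ l, HasDerivAt (fun z => QExpr τ ξ z E) 0 z := by
    intro z hz
    have hA := analyticAt_Xi ξ E hz
    have h0 := hA.differentiableAt.hasDerivAt
    have h1 := hA.deriv.differentiableAt.hasDerivAt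
    have h2 := hA.deriv.deriv.differentiableAt.hasDerivAt
    have hu := hasDerivAt_potential hz
    have ho := hξ.ode E z hz
    unfold QExpr
    simp only [iteratedDeriv_succ, iteratedDeriv_zero] at ho ⊢
    convert! ((h0.pow 2).mul (hu.const_sub E)).add ((h0.const_mul (1 / 2 : ℂ)).mul h2) |>.sub
      ((h1.pow 2).const_mul (1 / 4 : ℂ)) using 1
    simp only [Pi.pow_apply]
    linear_combination (-1 / 2 * Xi τ ξ z E) * ho
  exact (isOpen_regularSet τ l).is_const_of_deriv_eq_zero (isPreconnected_regularSet τ l)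
    (fun z hz => (hd z hz).differentiableAt.differentiableWithinAt)
    (fun z hz => (hd z hz).deriv) hx (quarter_mem_regularSet τ l)

/-- `Q₁(E) = ∫_ε^{1+ε} Ξ(x, E) dx`, along the horizontal segment. -/
def Q₁ (τ : UpperHalfPlane) {l : Fin 4 → ℕ} (ξ : XiCoeffs l) (ε E : ℂ) : ℂ :=
  ∫ t in (0 : ℝ)..1, Xi τ ξ (ε + t) E

/-- A domain on which the shift `x ↦ x + 1` can be studied: a connected open set without poles of
the potential, invariant under `x ↦ x + 1` and containing a horizontal line. The whole regular set
and a horizontal strip without poles are examples. -/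
structure IsShiftDomain (τ : UpperHalfPlane) (l : Fin 4 → ℕ) (U : Set ℂ) : Prop where
  isOpen : IsOpen U
  isPreconnected : IsPreconnected U
  subset : U ⊆ regularSet τ l
  shift : ∀ x ∈ U, x + 1 ∈ U
  line : ∃ a : ℂ, ∀ t : ℝ, a + t ∈ U

/-- `Λ` is, on `U`, a function `Λ(x, E) = √Ξ(x, E) · exp ∫ √(-Q(E)) dx / Ξ(x, E)`, where `s` is
the chosen value of `√(-Q(E))`: it is holomorphic on `U`, and near every point of `U` at which
`Ξ(·, E)` does not vanish it is the product of a holomorphic square root `r` of `Ξ` and `exp F`,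
with `F` a primitive of `s / Ξ`. -/
structure IsLambda (τ : UpperHalfPlane) {l : Fin 4 → ℕ} (ξ : XiCoeffs l) (U : Set ℂ) (E s : ℂ)
    (Λ : ℂ → ℂ) : Prop where
  sq_eq : s ^ 2 = -Q τ ξ E
  analytic : AnalyticOnNhd ℂ Λ U
  form : ∀ x ∈ U, Xi τ ξ x E ≠ 0 → ∃ r F : ℂ → ℂ, AnalyticAt ℂ r x ∧
    ∀ᶠ z in 𝓝 x, r z ^ 2 = Xi τ ξ z E ∧ HasDerivAt F (s / Xi τ ξ z E) z ∧
      Λ z = r z * Complex.exp (F z)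

/-- A path `γ` from `E₀` to `E₁` that meets the zeros of `Q` at most at its ends, together with a
continuous branch `y` of `√(-Q)` along it. -/
structure IsBranchedPath (τ : UpperHalfPlane) {l : Fin 4 → ℕ} (ξ : XiCoeffs l) (E₀ E₁ : ℂ)
    (γ y : ℝ → ℂ) : Prop where
  source : γ 0 = E₀
  target : γ 1 = E₁
  continuousOn : ContinuousOn γ (Set.Icc 0 1)
  contDiffOn : ContDiffOn ℝ 1 γ (Set.Ioo 0 1)
  ne_zero : ∀ t ∈ Set.Ioo (0 : ℝ) 1, Q τ ξ (γ t) ≠ 0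
  branch_continuousOn : ContinuousOn y (Set.Icc 0 1)
  branch_sq : ∀ t ∈ Set.Icc (0 : ℝ) 1, y t ^ 2 = -Q τ ξ (γ t)

/-- The integral `∫_γ Q₁(E) / √(-Q(E)) dE` along the path `γ` with the branch `y` of `√(-Q)`
converges, as an improper integral at both ends, and has the value `I`. -/
def HasPathIntegral (τ : UpperHalfPlane) {l : Fin 4 → ℕ} (ξ : XiCoeffs l) (ε : ℂ) (γ y : ℝ → ℂ)
    (I : ℂ) : Prop :=
  Tendsto (fun p : ℝ × ℝ => ∫ t in p.1..p.2, Q₁ τ ξ ε (γ t) / y t * deriv γ t)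
    (𝓝[>] 0 ×ˢ 𝓝[<] 1) (𝓝 I)

end Inozemtsev

end

noncomputable section

namespace Inozemtsev

/-! Write `Ξ_E` for `∂Ξ/∂E` and `'` for `∂/∂x`. Differentiating `r * exp F` gives the first-order
equation `Ξ Λ' = (Ξ'/2 + s) Λ`. Its coefficients have period 1, so the shift by 1 multiplies `Λ` by
`exp ∫ (Ξ'/2 + s)/Ξ`, the integral running over any unit horizontal segment in `U` without zeros of
`Ξ`; the identity theorem carries this over all of `U` (`shift_eq_mul_exp`). For `s = 0` the square
of this factor is `exp ∫ Ξ'/Ξ`, which is the factor of the periodic function `Ξ` itself, hence 1.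
This is the dichotomy at `E₀`.

Now let `E` vary. On a fixed segment without zeros, `∂_E (Ξ'/Ξ)` is the x-derivative of the periodic
function `Ξ_E/Ξ`, so `∫ Ξ'/Ξ` is locally constant in `E`. Differentiating the formula for `Q` in `E`
shows that `∂_E (√(-Q)/Ξ)` equals `-Ξ/(2√(-Q))` up to the x-derivative of a periodic function
(`Q_mul_integral_sub_eq`). Hence along the path the multiplier `B` satisfies `B' = -(1/2) (Q₁/√(-Q))
γ' B` (`hasDerivAt_multiplier`).

Zeros of `Ξ(·, E)` move with `E` and may cross any given segment, so the segment has to change along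
the path. Where `Q ≠ 0` this is harmless: at a zero of `Ξ` one has `(Ξ'/2)² = -Q = s²`, so the zero
is simple and `(Ξ'/2 + s)/Ξ` has residue 0 or 1 there. A single-valued solution then exists near the
segments (`exists_solution`), and all admissible segments give the same multiplier
(`multiplier_eq_multiplier`).

At the ends of the path `Q` may vanish, but a segment admissible at the end energy stays admissible
nearby, so `B` extends continuously to both ends, and it is an exponential, so never zero. The
logarithm of `B` therefore has limits at the ends; this yields both the convergence of the improper
integral and the formula (`exists_tendsto_integral_of_deriv_eq_mul`). -/

/-! ### The equation `f Λ' = N Λ` with 1-periodic coefficients. -/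

theorem eq_mul_exp_integral_of_deriv {Λ q : ℂ → ℂ} {b : ℂ}
    (hΛ : ∀ t ∈ Set.Icc (0 : ℝ) 1, HasDerivAt Λ (q (b + t) * Λ (b + t)) (b + t))
    (hq : ContinuousOn (fun t : ℝ => q (b + t)) (Set.Icc 0 1)) :
    Λ (b + 1) = Λ b * Complex.exp (∫ t in (0 : ℝ)..1, q (b + t)) := by
  -- Extending the integrand by its end values makes it continuous on the whole line, so its
  -- primitive has a two-sided derivative at 0 and 1 as well.
  set h : ℝ → ℂ := Set.IccExtend zero_le_one ((Set.Icc (0 : ℝ) 1).domRestrict fun t => q (b + t))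
    with hh
  have hcont : Continuous h := (continuousOn_iff_continuous_domRestrict.1 hq).Icc_extend'
  have heq : ∀ t ∈ Set.Icc (0 : ℝ) 1, h t = q (b + t) := fun t ht => by
    rw [hh, Set.IccExtend_of_mem _ _ ht]; rfl
  have hP : ∀ t, HasDerivAt (fun t => ∫ x in (0 : ℝ)..t, h x) (h t) t := fun t =>
    intervalIntegral.integral_hasDerivAt_right (hcont.intervalIntegrable _ _)
      (hcont.stronglyMeasurableAtFilter _ _) hcont.continuousAt
  have hder : ∀ t ∈ Set.Icc (0 : ℝ) 1, HasDerivAt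
      (fun t : ℝ => Λ (b + t) * Complex.exp (-∫ x in (0 : ℝ)..t, h x)) 0 t := by
    intro t ht
    have h1 : HasDerivAt (fun t : ℝ => Λ (b + t)) (q (b + t) * Λ (b + t)) t := by
      have := (hΛ t ht).comp_const_add b (t : ℂ)
      exact this.comp_ofReal
    convert! h1.mul (hP t).neg.cexp using 1
    rw [heq t ht]; ring
  have := constant_of_has_deriv_right_zero (a := (0 : ℝ)) (b := 1)
    (fun t ht => (hder t ht).continuousAt.continuousWithinAt)
    (fun t ht => (hder t ⟨ht.1, ht.2.le⟩).hasDerivWithinAt) 1 ⟨zero_le_one, le_rfl⟩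
  have hint : ∫ x in (0 : ℝ)..1, h x = ∫ t in (0 : ℝ)..1, q (b + t) :=
    intervalIntegral.integral_congr fun t ht => heq t (by rwa [Set.uIcc_of_le zero_le_one] at ht)
  simp only [Complex.ofReal_one, Complex.ofReal_zero, add_zero, intervalIntegral.integral_same,
    neg_zero, Complex.exp_zero, mul_one, hint] at this
  rw [← this, mul_assoc, ← Complex.exp_add]
  simp

/-- A nontrivial solution of `f Λ' = N Λ` with `1`-periodic `f`, `N` is multiplied by
`exp ∫ N / f` under the shift by `1`. -/
theorem shift_eq_mul_exp {V W : Set ℂ} {f N Λ : ℂ → ℂ} {b : ℂ} (hV : IsOpen V)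
    (hWo : IsOpen W) (hW : IsPreconnected W) (hWV : W ⊆ V) (hW1 : ∀ z ∈ W, z + 1 ∈ V)
    (hΛ : AnalyticOnNhd ℂ Λ V)
    (hne : ∀ z ∈ V, f z ≠ 0 → Λ z ≠ 0)
    (hsol : ∀ z ∈ V, f z ≠ 0 → deriv Λ z * f z = N z * Λ z)
    (hf : ContinuousOn f V) (hN : ContinuousOn N V)
    (hf1 : ∀ z, f (z + 1) = f z) (hN1 : ∀ z, N (z + 1) = N z)
    (hb : b ∈ W) (hbV : ∀ t ∈ Set.Icc (0 : ℝ) 1, b + t ∈ V)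
    (hbf : ∀ t ∈ Set.Icc (0 : ℝ) 1, f (b + t) ≠ 0) {z : ℂ} (hz : z ∈ W) :
    Λ (z + 1) = Λ z * Complex.exp (∫ t in (0 : ℝ)..1, N (b + t) / f (b + t)) := by
  have hder : ∀ z ∈ V, f z ≠ 0 → HasDerivAt Λ (N z / f z * Λ z) z := by
    intro z hz hfz
    convert! (hΛ z hz).differentiableAt.hasDerivAt using 1
    rw [div_mul_eq_mul_div, ← hsol z hz hfz, mul_div_assoc, div_self hfz, mul_one]
  have hmap : Set.MapsTo (fun t : ℝ => b + t) (Set.Icc 0 1) V := fun t ht => hbV t ht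
  have hlin : ContinuousOn (fun t : ℝ => b + (t : ℂ)) (Set.Icc 0 1) := by fun_prop
  have hbshift := eq_mul_exp_integral_of_deriv (q := fun z => N z / f z) (b := b)
    (fun t ht => hder _ (hbV t ht) (hbf t ht))
    ((hN.comp hlin hmap).div (hf.comp hlin hmap) hbf)
  set B := Complex.exp (∫ t in (0 : ℝ)..1, N (b + t) / f (b + t))
  have hfb : f b ≠ 0 := by simpa using hbf 0 (by simp)
  have hbV' : b ∈ V := hWV hb
  have hnear : ∀ᶠ z in 𝓝 b, z ∈ W ∧ f z ≠ 0 :=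
    (hWo.eventually_mem hb).and ((hf.continuousAt (hV.mem_nhds hbV')).eventually_ne hfb)
  obtain ⟨r, hr, hball⟩ := Metric.eventually_nhds_iff_ball.1 hnear
  -- `Λ (z + 1)` and `Λ z` have the same logarithmic derivative near `b`, so their quotient is
  -- constant there; the value at `b` comes from integrating along the segment.
  have hquot : ∀ z ∈ Metric.ball b r, HasDerivAt (fun z => Λ (z + 1) / Λ z) 0 z := by
    intro z hz
    obtain ⟨hzW, hfz⟩ := hball z hz
    have hΛz := hne z (hWV hzW) hfz
    have h1 := (hder (z + 1) (hW1 z hzW) (by rwa [hf1])).comp_add_const z 1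
    convert! h1.div (hder z (hWV hzW) hfz) hΛz using 1
    rw [hf1, hN1]
    ring
  have hconst : ∀ z ∈ Metric.ball b r, Λ (z + 1) = Λ z * B := by
    intro z hz
    have := Metric.isOpen_ball.is_const_of_deriv_eq_zero (convex_ball b r).isPreconnected
      (fun z hz => (hquot z hz).differentiableAt.differentiableWithinAt)
      (fun z hz => (hquot z hz).deriv) hz (Metric.mem_ball_self hr)
    beta_reduce at this
    have hΛz := hne z (hWV (hball z hz).1) (hball z hz).2
    have hΛb := hne b hbV' hfb
    rw [div_eq_iff hΛz, hbshift, mul_div_cancel_left₀ _ hΛb] at this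
    rw [this, mul_comm]
  have hA1 : AnalyticOnNhd ℂ (fun z => Λ (z + 1)) W := fun z hz =>
    (hΛ (z + 1) (hW1 z hz)).comp_of_eq (by fun_prop) rfl
  have hA2 : AnalyticOnNhd ℂ (fun z => Λ z * B) W := fun z hz =>
    (hΛ z (hWV hz)).mul analyticAt_const
  exact hA1.eqOn_of_preconnected_of_eventuallyEq hA2 hW hb
    (Metric.eventually_nhds_iff_ball.2 ⟨r, hr, hconst⟩) hz

/-- Solvability of `f Λ' = N Λ` on a convex open set when `f` has finitely many zeros, all simple,
and `N / f` has residue `0` or `1` at each of them. -/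
theorem exists_solution {Ω : Set ℂ} (hΩ : IsOpen Ω) (hconv : Convex ℝ Ω) (S : Finset ℂ) :
    ∀ f N : ℂ → ℂ, DifferentiableOn ℂ f Ω → DifferentiableOn ℂ N Ω →
      (∀ u ∈ Ω, f u = 0 → u ∈ S) →
      (∀ u ∈ Ω, f u = 0 → deriv f u ≠ 0 ∧ (N u = 0 ∨ N u = deriv f u)) →
      ∃ Λ : ℂ → ℂ, DifferentiableOn ℂ Λ Ω ∧ (∀ z ∈ Ω, f z ≠ 0 → Λ z ≠ 0) ∧
        ∀ z ∈ Ω, deriv Λ z * f z = N z * Λ z := by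
  classical
  induction S using Finset.induction_on with
  | empty =>
    intro f N hf hN hS _
    have hne : ∀ z ∈ Ω, f z ≠ 0 := fun z hz h => by simpa using hS z hz h
    obtain ⟨g, hg⟩ := hconv.exists_forall_hasDerivWithinAt (hN.div hf hne)
    have hg' : ∀ z ∈ Ω, HasDerivAt (fun z => Complex.exp (g z))
        (Complex.exp (g z) * (N z / f z)) z := fun z hz =>
      ((hg z hz).hasDerivAt (hΩ.mem_nhds hz)).cexp
    refine ⟨fun z => Complex.exp (g z), fun z hz => (hg' z hz).differentiableAt.differentiableWithinAt,
      fun z _ _ => Complex.exp_ne_zero _, fun z hz => ?_⟩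
    rw [(hg' z hz).deriv]
    field_simp [hne z hz]
  | insert u S _ ih =>
    intro f N hf hN hS hres
    by_cases hu : u ∈ Ω ∧ f u = 0
    swap
    · refine ih f N hf hN (fun v hv hfv => ?_) hres
      rcases Finset.mem_insert.1 (hS v hv hfv) with rfl | h
      · exact absurd ⟨hv, hfv⟩ hu
      · exact h
    obtain ⟨huΩ, hfu⟩ := hu
    have hfac : ∀ g : ℂ → ℂ, g u = 0 → ∀ z, g z = (z - u) * dslope g u z := fun g hg z => by
      have := sub_smul_dslope g u z
      rw [hg, sub_zero, smul_eq_mul] at this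
      exact this.symm
    have hd : ∀ g : ℂ → ℂ, DifferentiableOn ℂ g Ω → DifferentiableOn ℂ (dslope g u) Ω :=
      fun g hg => (Complex.differentiableOn_dslope (hΩ.mem_nhds huΩ)).2 hg
    have hf1u : dslope f u u ≠ 0 := by rw [dslope_same]; exact (hres u huΩ hfu).1
    have hf1z : ∀ v, dslope f u v = 0 → v ≠ u ∧ f v = 0 := fun v hv =>
      ⟨fun h => hf1u (h ▸ hv), by rw [hfac f hfu, hv, mul_zero]⟩
    -- With residue 0 at `u`, the factor `z - u` cancels from both `f` and `N`. At another zero `v`,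
    -- `f'` and `N` are both divided by the nonzero number `v - u`, so the condition there survives.
    have key : ∀ N : ℂ → ℂ, DifferentiableOn ℂ N Ω → N u = 0 →
        (∀ v ∈ Ω, v ≠ u → f v = 0 → deriv f v ≠ 0 ∧ (N v = 0 ∨ N v = deriv f v)) →
        ∃ Λ : ℂ → ℂ, DifferentiableOn ℂ Λ Ω ∧ (∀ z ∈ Ω, f z ≠ 0 → Λ z ≠ 0) ∧
          ∀ z ∈ Ω, deriv Λ z * f z = N z * Λ z := by
      intro N hN hNu hres
      obtain ⟨Λ, h1, h2, h3⟩ := ih (dslope f u) (dslope N u) (hd f hf) (hd N hN)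
        (fun v hv hfv => (Finset.mem_insert.1 (hS v hv (hf1z v hfv).2)).resolve_left
          (hf1z v hfv).1) (fun v hv hfv => by
          obtain ⟨hvu, hfv0⟩ := hf1z v hfv
          obtain ⟨hr1, hr2⟩ := hres v hv hvu hfv0
          have hvu' : v - u ≠ 0 := sub_ne_zero.2 hvu
          have hder : deriv f v = (v - u) * deriv (dslope f u) v := by
            have h1 : HasDerivAt (fun z => (z - u) * dslope f u z)
                (1 * dslope f u v + (v - u) * deriv (dslope f u) v) v :=
              ((hasDerivAt_id v).sub_const u).mul
                ((hd f hf).differentiableAt (hΩ.mem_nhds hv)).hasDerivAt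
            rw [hfv, mul_zero, zero_add] at h1
            rw [← h1.deriv]
            exact congrArg (fun g => deriv g v) (funext (hfac f hfu))
          refine ⟨fun h => hr1 (by rw [hder, h, mul_zero]), ?_⟩
          rw [hder, hfac N hNu v] at hr2
          rcases hr2 with h | h
          · exact Or.inl ((mul_eq_zero.1 h).resolve_left hvu')
          · exact Or.inr (mul_left_cancel₀ hvu' h))
      refine ⟨Λ, h1, fun z hz hfz => h2 z hz fun h => hfz (hf1z z h).2, fun z hz => ?_⟩
      rw [hfac f hfu z, hfac N hNu z]
      linear_combination (z - u) * h3 z hz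
    rcases (hres u huΩ hfu).2 with hNu | hNu
    · exact key N hN hNu fun v hv _ hfv => hres v hv hfv
    -- With residue 1, substituting `Λ = (z - u) M` replaces `N` by `N - f/(z - u)`, which vanishes
    -- at `u` and agrees with `N` at the other zeros of `f`.
    · obtain ⟨M, h1, h2, h3⟩ := key (fun z => N z - dslope f u z) (hN.sub (hd f hf))
        (by simp [hNu]) (fun v hv hvu hfv => by
          have h0 : dslope f u v = 0 := by
            have := hfac f hfu v
            rw [hfv] at this
            exact (mul_eq_zero.1 this.symm).resolve_left (sub_ne_zero.2 hvu)
          simpa [h0] using hres v hv hfv)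
      refine ⟨fun z => (z - u) * M z, by fun_prop, fun z hz hfz => mul_ne_zero
        (sub_ne_zero.2 fun h => hfz (h ▸ hfu)) (h2 z hz hfz), fun z hz => ?_⟩
      have hM : HasDerivAt (fun z => (z - u) * M z) (1 * M z + (z - u) * deriv M z) z :=
        ((hasDerivAt_id z).sub_const u).mul (h1.differentiableAt (hΩ.mem_nhds hz)).hasDerivAt
      rw [hM.deriv]
      linear_combination (z - u) * h3 z hz + M z * hfac f hfu z

/-! ### Square-root branches, parameter integrals and improper integrals. -/

/-- The difference quotient of `y` is that of `g` divided by `y x + y t`, so continuity of the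
branch already forces differentiability where it is nonzero. -/
theorem hasDerivAt_of_sq_eq {y g : ℝ → ℂ} {g' : ℂ} {t : ℝ} (hg : HasDerivAt g g' t)
    (hy : ContinuousAt y t) (h : ∀ᶠ x in 𝓝 t, y x ^ 2 = g x) (h0 : y t ≠ 0) :
    HasDerivAt y (g' / (2 * y t)) t := by
  rw [hasDerivAt_iff_tendsto_slope] at hg ⊢
  have hsum : Tendsto (fun x => y x + y t) (𝓝[≠] t) (𝓝 (2 * y t)) := by
    rw [two_mul]
    exact (hy.tendsto.mono_left nhdsWithin_le_nhds).add_const _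
  have h20 : 2 * y t ≠ 0 := mul_ne_zero two_ne_zero h0
  refine (hg.div hsum h20).congr' ?_
  filter_upwards [h.filter_mono nhdsWithin_le_nhds, hsum.eventually_ne h20] with x hx hx0
  rw [Pi.div_apply, slope_def_module, slope_def_module, ← hx, ← h.self_of_nhds, div_eq_iff hx0, smul_mul_assoc]
  congr 1
  ring

theorem hasDerivAt_integral_of_continuousOn {F F' : ℂ → ℝ → ℂ} {V : Set ℂ} (hV : IsOpen V)
    {E : ℂ} (hE : E ∈ V)
    (hF : ContinuousOn (fun p : ℂ × ℝ => F p.1 p.2) (V ×ˢ Set.Icc 0 1))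
    (hF' : ContinuousOn (fun p : ℂ × ℝ => F' p.1 p.2) (V ×ˢ Set.Icc 0 1))
    (hd : ∀ e ∈ V, ∀ t ∈ Set.Icc (0 : ℝ) 1, HasDerivAt (fun e => F e t) (F' e t) e) :
    HasDerivAt (fun e => ∫ t in (0 : ℝ)..1, F e t) (∫ t in (0 : ℝ)..1, F' E t) E := by
  obtain ⟨r, hr, hrV⟩ := Metric.nhds_basis_closedBall.mem_iff.1 (hV.mem_nhds hE)
  obtain ⟨K, hK⟩ := ((isCompact_closedBall E r).prod (isCompact_Icc (a := (0 : ℝ)) (b := 1)))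
    |>.exists_bound_of_continuousOn (hF'.mono (Set.prod_mono hrV subset_rfl))
  have hsec : ∀ G : ℂ → ℝ → ℂ, ContinuousOn (fun p : ℂ × ℝ => G p.1 p.2) (V ×ˢ Set.Icc 0 1) →
      ∀ e ∈ V, ContinuousOn (G e) (Set.Icc 0 1) := fun G hG e he =>
    hG.comp (f := fun t : ℝ => (e, t)) (by fun_prop) fun t ht => ⟨he, ht⟩
  have hI : Set.uIoc (0 : ℝ) 1 ⊆ Set.Icc 0 1 := by
    rw [Set.uIoc_of_le zero_le_one]; exact Set.Ioc_subset_Icc_self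
  have hmeas : ∀ G : ℝ → ℂ, ContinuousOn G (Set.Icc 0 1) →
      MeasureTheory.AEStronglyMeasurable G (MeasureTheory.volume.restrict (Set.uIoc (0 : ℝ) 1)) :=
    fun G hG => (hG.mono hI).aestronglyMeasurable measurableSet_uIoc
  refine (intervalIntegral.hasDerivAt_integral_of_dominated_loc_of_deriv_le
    (bound := fun _ => K) (F' := F') (Metric.closedBall_mem_nhds E hr) ?_ ?_ ?_ ?_ ?_ ?_).2
  · filter_upwards [hV.mem_nhds hE] with e he using hmeas _ (hsec F hF e he)
  · exact (hsec F hF E hE).intervalIntegrable_of_Icc zero_le_one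
  · exact hmeas _ (hsec F' hF' E hE)
  · exact .of_forall fun t ht e he => hK (e, t) ⟨he, hI ht⟩
  · exact intervalIntegrable_const
  · exact .of_forall fun t ht e he => hd e (hrV he) t (hI ht)

/-- Close to the end, `B / B e` is near 1, so its principal logarithm is defined and `F + 2 log (B /
B e)` is constant. The filter `l` stands for either one-sided neighbourhood; `hJ` supplies connected
open sets on which constancy can be concluded. -/
theorem exists_tendsto_of_deriv_eq_mul {f F B : ℝ → ℂ} {e : ℝ} {l : Filter ℝ} {J : Set ℝ}
    [l.NeBot] (hl : Tendsto B l (𝓝 (B e))) (hBe : B e ≠ 0) (hJl : J ∈ l)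
    (hJ : ∀ s ∈ l, ∃ J' ∈ l, IsOpen J' ∧ IsPreconnected J' ∧ J' ⊆ s)
    (hd : ∀ t ∈ J, HasDerivAt B (-(1 / 2) * f t * B t) t)
    (hF : ∀ t ∈ J, HasDerivAt F (f t) t) : ∃ L, Tendsto F l (𝓝 L) := by
  have hlim : Tendsto (fun t => B t / B e) l (𝓝 1) := by
    simpa [hBe] using hl.div_const (B e)
  have hslit : {t | B t / B e ∈ Complex.slitPlane} ∈ l :=
    hlim (Complex.isOpen_slitPlane.mem_nhds Complex.one_mem_slitPlane)
  obtain ⟨J', hJ'l, hJ'o, hJ'c, hJ's⟩ := hJ _ (inter_mem hJl hslit)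
  obtain ⟨c, hc⟩ := l.nonempty_of_mem hJ'l
  have hG : ∀ t ∈ J', HasDerivAt (fun t => F t + 2 * Complex.log (B t / B e)) 0 t := by
    intro t ht
    obtain ⟨htJ, hts⟩ := hJ's ht
    have hBt : B t ≠ 0 := fun h => Complex.slitPlane_ne_zero hts (by rw [h, zero_div])
    convert! (hF t htJ).add ((((hd t htJ).div_const (B e)).clog_real hts).const_mul 2) using 1
    field_simp
    ring
  have hconst : ∀ t ∈ J', F t = (F c + 2 * Complex.log (B c / B e)) -
      2 * Complex.log (B t / B e) := by
    intro t ht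
    have := hJ'o.is_const_of_deriv_eq_zero hJ'c
      (fun z hz => (hG z hz).differentiableAt.differentiableWithinAt)
      (fun z hz => (hG z hz).deriv) hc ht
    beta_reduce at this
    rw [this, add_sub_cancel_right]
  refine ⟨(F c + 2 * Complex.log (B c / B e)) - 2 * Complex.log 1,
    Tendsto.congr' (f₁ := fun t => (F c + 2 * Complex.log (B c / B e)) -
      2 * Complex.log (B t / B e)) ?_ ((hlim.clog Complex.one_mem_slitPlane).const_mul 2
        |>.const_sub _)⟩
  filter_upwards [hJ'l] with t ht using (hconst t ht).symm

/-- If `B' = -(1/2) f B` on `(0, 1)` and `B` extends continuously without zeros to `[0, 1]`, then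
the improper integral of `f` over `(0, 1)` converges and measures the change of `B`. -/
theorem exists_tendsto_integral_of_deriv_eq_mul {f B : ℝ → ℂ}
    (hf : ContinuousOn f (Set.Ioo 0 1)) (hB : ContinuousOn B (Set.Icc 0 1))
    (hB0 : B 0 ≠ 0) (hB1 : B 1 ≠ 0)
    (hd : ∀ t ∈ Set.Ioo (0 : ℝ) 1, HasDerivAt B (-(1 / 2) * f t * B t) t) :
    ∃ I, Tendsto (fun p : ℝ × ℝ => ∫ t in p.1..p.2, f t) (𝓝[>] 0 ×ˢ 𝓝[<] 1) (𝓝 I) ∧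
      B 1 = B 0 * Complex.exp (-(1 / 2) * I) := by
  set F : ℝ → ℂ := fun t => ∫ x in (1 / 2 : ℝ)..t, f x with hFdef
  have hhalf : (1 / 2 : ℝ) ∈ Set.Ioo (0 : ℝ) 1 := by norm_num
  have hint : ∀ p ∈ Set.Ioo (0 : ℝ) 1, ∀ q ∈ Set.Ioo (0 : ℝ) 1,
      IntervalIntegrable f MeasureTheory.volume p q := fun p hp q hq =>
    (hf.mono (Set.ordConnected_Ioo.uIcc_subset hp hq)).intervalIntegrable
  have hF : ∀ t ∈ Set.Ioo (0 : ℝ) 1, HasDerivAt F (f t) t := fun t ht =>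
    intervalIntegral.integral_hasDerivAt_right (hint _ hhalf t ht)
      (hf.stronglyMeasurableAtFilter isOpen_Ioo t ht) (hf.continuousAt (isOpen_Ioo.mem_nhds ht))
  have h0l : Set.Ioo (0 : ℝ) 1 ∈ 𝓝[>] (0 : ℝ) := Ioo_mem_nhdsGT zero_lt_one
  have h1l : Set.Ioo (0 : ℝ) 1 ∈ 𝓝[<] (1 : ℝ) := Ioo_mem_nhdsLT zero_lt_one
  have hBl0 : Tendsto B (𝓝[>] 0) (𝓝 (B 0)) :=
    (hB 0 (by simp)).tendsto.mono_left (nhdsWithin_le_of_mem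
      (mem_of_superset h0l Set.Ioo_subset_Icc_self))
  have hBl1 : Tendsto B (𝓝[<] 1) (𝓝 (B 1)) :=
    (hB 1 (by simp)).tendsto.mono_left (nhdsWithin_le_of_mem
      (mem_of_superset h1l Set.Ioo_subset_Icc_self))
  obtain ⟨L0, hL0⟩ := exists_tendsto_of_deriv_eq_mul hBl0 hB0 h0l (fun s hs => by
    obtain ⟨u, hu, hus⟩ := mem_nhdsGT_iff_exists_Ioo_subset.1 hs
    exact ⟨_, Ioo_mem_nhdsGT hu, isOpen_Ioo, isPreconnected_Ioo, hus⟩) hd hF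
  obtain ⟨L1, hL1⟩ := exists_tendsto_of_deriv_eq_mul hBl1 hB1 h1l (fun s hs => by
    obtain ⟨u, hu, hus⟩ := mem_nhdsLT_iff_exists_Ioo_subset.1 hs
    exact ⟨_, Ioo_mem_nhdsLT hu, isOpen_Ioo, isPreconnected_Ioo, hus⟩) hd hF
  have hexp : ∀ t ∈ Set.Ioo (0 : ℝ) 1, B t * Complex.exp (1 / 2 * F t) = B (1 / 2) := by
    have hz : ∀ t ∈ Set.Ioo (0 : ℝ) 1,
        HasDerivAt (fun t => B t * Complex.exp (1 / 2 * F t)) 0 t := by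
      intro t ht
      convert! (hd t ht).mul ((hF t ht).const_mul (1 / 2)).cexp using 1
      ring
    intro t ht
    have := isOpen_Ioo.is_const_of_deriv_eq_zero isPreconnected_Ioo
      (fun z hz' => (hz z hz').differentiableAt.differentiableWithinAt)
      (fun z hz' => (hz z hz').deriv) ht hhalf
    beta_reduce at this
    rw [this, hFdef]
    simp
  have hend : ∀ {l : Filter ℝ} [l.NeBot] {β L : ℂ}, Tendsto B l (𝓝 β) → Tendsto F l (𝓝 L) →
      Set.Ioo (0 : ℝ) 1 ∈ l → β * Complex.exp (1 / 2 * L) = B (1 / 2) := by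
    intro l _ β L h1 h2 h3
    refine tendsto_nhds_unique (h1.mul (h2.const_mul (1 / 2)).cexp)
      (tendsto_const_nhds.congr' ?_)
    filter_upwards [h3] with t ht using (hexp t ht).symm
  refine ⟨L1 - L0, ?_, ?_⟩
  · refine ((hL1.comp tendsto_snd).sub (hL0.comp tendsto_fst)).congr' ?_
    filter_upwards [prod_mem_prod h0l h1l] with p hp
    exact intervalIntegral.integral_interval_sub_left (hint _ hhalf _ hp.2) (hint _ hhalf _ hp.1)
  · have h := (hend hBl1 hL1 h1l).trans (hend hBl0 hL0 h0l).symm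
    have h1 : Complex.exp (1 / 2 * L1) * Complex.exp (-(1 / 2) * (L1 - L0)) =
        Complex.exp (1 / 2 * L0) := by
      rw [← Complex.exp_add]; congr 1; ring
    refine mul_right_cancel₀ (Complex.exp_ne_zero (1 / 2 * L1)) ?_
    rw [h, mul_assoc, mul_comm (Complex.exp _) (Complex.exp (1 / 2 * L1)), h1]

/-! ### Periodicity of `Ξ` and its derivatives in `x` and `E`. -/

theorem one_mem_lattice (τ : UpperHalfPlane) : (1 : ℂ) ∈ (periods τ).lattice :=
  (periods τ).ω₁_mem_lattice

theorem tau_mem_lattice (τ : UpperHalfPlane) : (τ : ℂ) ∈ (periods τ).lattice :=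
  (periods τ).ω₂_mem_lattice

theorem wp_add_of_mem {τ : UpperHalfPlane} {ω : ℂ} (hω : ω ∈ (periods τ).lattice) (i : Fin 4)
    (x : ℂ) : wp τ i (x + ω) = wp τ i x := by
  unfold wp
  rw [add_right_comm]
  exact (periods τ).weierstrassP_add_coe (x + halfPeriod τ i) ⟨ω, hω⟩

theorem Xi_add_one {τ : UpperHalfPlane} {l : Fin 4 → ℕ} (ξ : XiCoeffs l) (x E : ℂ) :
    Xi τ ξ (x + 1) E = Xi τ ξ x E := by
  simp only [Xi, wp_add_of_mem (one_mem_lattice τ)]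

theorem iteratedDeriv_Xi_add_one {τ : UpperHalfPlane} {l : Fin 4 → ℕ} (ξ : XiCoeffs l) (n : ℕ)
    (x E : ℂ) : iteratedDeriv n (fun z => Xi τ ξ z E) (x + 1) =
      iteratedDeriv n (fun z => Xi τ ξ z E) x := by
  have := congrFun (iteratedDeriv_comp_add_const n (fun z => Xi τ ξ z E) 1) x
  simp only [Xi_add_one] at this
  exact this.symm

theorem analyticAt_wp_pow {τ : UpperHalfPlane} {l : Fin 4 → ℕ} {x : ℂ} (hx : x ∈ regularSet τ l)
    (i : Fin 4) (j : Fin (l i)) : AnalyticAt ℂ (fun z => wp τ i z ^ (l i - (j : ℕ))) x :=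
  (analyticAt_wp hx (by have := j.2; omega)).fun_pow _

/-- Separates the variables: polynomials in `E` times functions of `x`. Joint continuity and the
interchange of `∂/∂E` with x-derivatives are read off from this form. -/
theorem iteratedDeriv_Xi {τ : UpperHalfPlane} {l : Fin 4 → ℕ} (ξ : XiCoeffs l) (n : ℕ)
    {x : ℂ} (hx : x ∈ regularSet τ l) (E : ℂ) :
    iteratedDeriv n (fun z => Xi τ ξ z E) x = ξ.c.eval E * iteratedDeriv n (fun _ => (1 : ℂ)) x +
      ∑ i, ∑ j : Fin (l i), (ξ.b i j).eval E *
        iteratedDeriv n (fun z => wp τ i z ^ (l i - (j : ℕ))) x := by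
  have hA : ∀ i, ∀ j : Fin (l i), ContDiffAt ℂ n
      (fun z => (ξ.b i j).eval E * wp τ i z ^ (l i - (j : ℕ))) x := fun i j =>
    (analyticAt_const.mul (analyticAt_wp_pow hx i j)).contDiffAt
  have hS : ∀ i, ContDiffAt ℂ n
      (fun z => ∑ j : Fin (l i), (ξ.b i j).eval E * wp τ i z ^ (l i - (j : ℕ))) x := fun i =>
    ContDiffAt.sum fun j _ => hA i j
  have h0 : (fun z => Xi τ ξ z E) = (fun z => ξ.c.eval E * (fun _ => (1 : ℂ)) z) +
      fun z => ∑ i, ∑ j : Fin (l i), (ξ.b i j).eval E * wp τ i z ^ (l i - (j : ℕ)) := by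
    funext z; simp [Xi]
  rw [h0, iteratedDeriv_add (by fun_prop) (ContDiffAt.sum fun i _ => hS i),
    iteratedDeriv_const_mul_field, iteratedDeriv_fun_sum fun i _ => hS i]
  congr 1
  refine Finset.sum_congr rfl fun i _ => ?_
  rw [iteratedDeriv_fun_sum fun j _ => hA i j]
  exact Finset.sum_congr rfl fun j _ => iteratedDeriv_const_mul_field _ _

/-- The coefficients of `∂Ξ/∂E`. -/
def XiCoeffs.derivative {l : Fin 4 → ℕ} (ξ : XiCoeffs l) : XiCoeffs l where
  c := Polynomial.derivative ξ.c
  b i j := Polynomial.derivative (ξ.b i j)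

theorem hasDerivAt_iteratedDeriv_Xi_energy {τ : UpperHalfPlane} {l : Fin 4 → ℕ} (ξ : XiCoeffs l)
    (n : ℕ) {x : ℂ} (hx : x ∈ regularSet τ l) (E : ℂ) :
    HasDerivAt (fun E => iteratedDeriv n (fun z => Xi τ ξ z E) x)
      (iteratedDeriv n (fun z => Xi τ ξ.derivative z E) x) E := by
  simp only [iteratedDeriv_Xi _ n hx]
  exact ((ξ.c.hasDerivAt E).mul_const _).add (HasDerivAt.fun_sum fun i _ =>
    HasDerivAt.fun_sum fun j _ => ((ξ.b i j).hasDerivAt E).mul_const _)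

theorem analyticAt_iteratedDeriv_Xi {τ : UpperHalfPlane} {l : Fin 4 → ℕ} (ξ : XiCoeffs l)
    (n : ℕ) {x : ℂ} (hx : x ∈ regularSet τ l) (E : ℂ) :
    AnalyticAt ℂ (iteratedDeriv n (fun z => Xi τ ξ z E)) x := by
  rw [iteratedDeriv_eq_iterate]
  exact (analyticAt_Xi ξ E hx).iterated_deriv n

theorem hasDerivAt_iteratedDeriv_Xi {τ : UpperHalfPlane} {l : Fin 4 → ℕ} (ξ : XiCoeffs l)
    (n : ℕ) {x : ℂ} (hx : x ∈ regularSet τ l) (E : ℂ) :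
    HasDerivAt (iteratedDeriv n (fun z => Xi τ ξ z E))
      (iteratedDeriv (n + 1) (fun z => Xi τ ξ z E) x) x := by
  rw [iteratedDeriv_succ]
  exact (analyticAt_iteratedDeriv_Xi ξ n hx E).differentiableAt.hasDerivAt

theorem continuousOn_iteratedDeriv_Xi {τ : UpperHalfPlane} {l : Fin 4 → ℕ} (ξ : XiCoeffs l)
    (n : ℕ) : ContinuousOn (fun p : ℂ × ℂ => iteratedDeriv n (fun z => Xi τ ξ z p.2) p.1)
      (regularSet τ l ×ˢ Set.univ) := by
  have hg : ∀ g : ℂ → ℂ, (∀ x ∈ regularSet τ l, AnalyticAt ℂ g x) →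
      ContinuousOn (fun p : ℂ × ℂ => iteratedDeriv n g p.1) (regularSet τ l ×ˢ Set.univ) := by
    intro g hg
    have : ContinuousOn (iteratedDeriv n g) (regularSet τ l) := fun x hx => by
      rw [iteratedDeriv_eq_iterate]
      exact ((hg x hx).iterated_deriv n).continuousAt.continuousWithinAt
    exact this.comp continuousOn_fst fun p hp => hp.1
  have hp : ∀ P : ℂ[X], ContinuousOn (fun p : ℂ × ℂ => P.eval p.2)
      (regularSet τ l ×ˢ Set.univ) := fun P => (P.continuous.comp continuous_snd).continuousOn
  refine ContinuousOn.congr (f := fun p : ℂ × ℂ =>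
    ξ.c.eval p.2 * iteratedDeriv n (fun _ => (1 : ℂ)) p.1 + ∑ i, ∑ j : Fin (l i),
      (ξ.b i j).eval p.2 * iteratedDeriv n (fun z => wp τ i z ^ (l i - (j : ℕ))) p.1) ?_
    fun p hp => iteratedDeriv_Xi ξ n hp.1 p.2
  exact ((hp _).mul (hg _ fun _ _ => analyticAt_const)).add (continuousOn_finsetSum _ fun i _ =>
    continuousOn_finsetSum _ fun j _ => (hp _).mul (hg _ fun x hx => analyticAt_wp_pow hx i j))

/-! ### Zeros of `Ξ(·, E)`. -/

theorem halfPeriod_sub_notMem_lattice (τ : UpperHalfPlane) {i k : Fin 4} (h : k ≠ i) :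
    -halfPeriod τ i + halfPeriod τ k ∉ (periods τ).lattice := by
  intro hmem
  obtain ⟨m, n, hmn⟩ := PeriodPair.mem_lattice.mp hmem
  change (m : ℂ) * 1 + (n : ℂ) * (τ : ℂ) = _ at hmn
  -- Twice each half-period has integer coordinates in the basis `1, τ`; the four coordinate pairs
  -- differ modulo 2, and the contradiction is one of parity.
  have hp : ∀ i, halfPeriod τ i =
      ((![0, 1, -1, 0] i : ℤ) + (![0, 0, -1, 1] i : ℤ) * (τ : ℂ)) / 2 := by
    intro i
    fin_cases i <;> simp [halfPeriod]
  rw [hp, hp] at hmn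
  have key : ∀ a b : ℤ, (a : ℂ) + b * (τ : ℂ) = 0 → a = 0 ∧ b = 0 := by
    intro a b h
    have him := congrArg Complex.im h
    have hre := congrArg Complex.re h
    simp [τ.im_pos.ne'] at him
    simp [him] at hre
    exact ⟨hre, him⟩
  obtain ⟨h1, h2⟩ := key (2 * m - (![0, 1, -1, 0] k - ![0, 1, -1, 0] i))
    (2 * n - (![0, 0, -1, 1] k - ![0, 0, -1, 1] i)) (by push_cast; linear_combination 2 * hmn)
  fin_cases i <;> fin_cases k <;> simp at h h1 h2 <;> omega

theorem tendsto_wp_cobounded (τ : UpperHalfPlane) (i : Fin 4) :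
    Tendsto (wp τ i) (𝓝[≠] (-halfPeriod τ i)) (Bornology.cobounded ℂ) := by
  have h := tendsto_cobounded_of_meromorphicOrderAt_neg
    (f := (periods τ).weierstrassP) (x := 0) (by
      rw [PeriodPair.order_weierstrassP _ _ (zero_mem _)]; decide)
  refine h.comp (tendsto_nhdsWithin_iff.2 ⟨?_, ?_⟩)
  · have : ContinuousAt (fun x => x + halfPeriod τ i) (-halfPeriod τ i) := by fun_prop
    simpa [ContinuousAt] using this.tendsto.mono_left nhdsWithin_le_nhds
  · filter_upwards [self_mem_nhdsWithin] with x hx h0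
    exact hx (eq_neg_of_add_eq_zero_left h0)

theorem eventually_mem_regularSet (τ : UpperHalfPlane) (l : Fin 4 → ℕ) (x : ℂ) :
    ∀ᶠ z in 𝓝[≠] x, z ∈ regularSet τ l := by
  have : ∀ i : Fin 4, ∀ᶠ z in 𝓝[≠] x, z + halfPeriod τ i ∉ (periods τ).lattice := by
    intro i
    have hc : Tendsto (fun z => z + halfPeriod τ i) (𝓝 x) (𝓝 (x + halfPeriod τ i)) :=
      (continuous_add_const _).continuousAt
    filter_upwards [nhdsWithin_le_nhds (hc.eventually
      ((periods τ).compl_lattice_sdiff_singleton_mem_nhds (x + halfPeriod τ i))),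
      self_mem_nhdsWithin] with z hz hzx hmem
    exact hz ⟨hmem, fun h => hzx (add_right_cancel h)⟩
  filter_upwards [eventually_all.2 this] with z hz i _ using hz i

/-- For no energy does `Ξ(·, E)` vanish identically. -/
theorem exists_Xi_ne_zero {τ : UpperHalfPlane} {l : Fin 4 → ℕ} {ξ : XiCoeffs l} (hξ : IsXi τ ξ)
    (E : ℂ) : ∃ x ∈ regularSet τ l, Xi τ ξ x E ≠ 0 := by
  by_contra! hzero
  have hb : ∀ i j, (ξ.b i j).eval E = 0 := by
    intro i j
    -- Near the pole `-ω_i` of `℘(x + ω_i)`, vanishing of `Ξ` equates a polynomial `P` in that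
    -- function with `G`, which is continuous there. So `P` is constant; all its exponents `l i - j`
    -- being positive, its coefficients vanish.
    set P : ℂ[X] := ∑ j : Fin (l i), Polynomial.monomial (l i - (j : ℕ)) ((ξ.b i j).eval E)
      with hP
    set G : ℂ → ℂ := fun x => -(ξ.c.eval E + ∑ k ∈ Finset.univ.erase i, ∑ j : Fin (l k),
      (ξ.b k j).eval E * wp τ k x ^ (l k - (j : ℕ))) with hG
    have hG0 : ContinuousAt G (-halfPeriod τ i) := by
      refine (continuousAt_const.add (tendsto_finsetSum _ fun k hk =>
        tendsto_finsetSum _ fun j _ => ?_)).neg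
      have hk' := halfPeriod_sub_notMem_lattice τ (Finset.ne_of_mem_erase hk)
      have : ContinuousAt (wp τ k) (-halfPeriod τ i) :=
        (((periods τ).analyticOnNhd_weierstrassP _ hk').comp_of_eq
          (f := fun x => x + halfPeriod τ k) (by fun_prop) rfl).continuousAt
      exact (continuousAt_const.mul (this.pow _)).tendsto
    have hPG : ∀ᶠ x in 𝓝[≠] (-halfPeriod τ i), ‖G x‖ = ‖P.eval (wp τ i x)‖ := by
      filter_upwards [eventually_mem_regularSet τ l (-halfPeriod τ i)] with x hx
      congr 1
      have := hzero x hx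
      rw [Xi, ← Finset.add_sum_erase _ _ (Finset.mem_univ i)] at this
      simp only [hG, hP, Polynomial.eval_finsetSum, Polynomial.eval_monomial]
      linear_combination -this
    have hdeg : ¬ 0 < P.degree := by
      intro hdeg
      have h1 := P.tendsto_norm_atTop hdeg
        (tendsto_norm_cobounded_atTop.comp (tendsto_wp_cobounded τ i))
      exact not_tendsto_atTop_of_tendsto_nhds
        (hG0.tendsto.mono_left nhdsWithin_le_nhds).norm (h1.congr' (hPG.mono fun _ h => h.symm))
    have hc : P.coeff (l i - (j : ℕ)) = (ξ.b i j).eval E := by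
      rw [hP, Polynomial.finsetSum_coeff, Finset.sum_eq_single j]
      · simp
      · intro k _ hk
        rw [Polynomial.coeff_monomial, if_neg]
        intro h
        apply hk
        ext
        have := k.2
        have := j.2
        omega
      · simp
    rw [← hc, Polynomial.eq_C_of_degree_le_zero (not_lt.1 hdeg), Polynomial.coeff_C, if_neg]
    have := j.2
    omega
  have hc : ξ.c.eval E = 0 := by
    have := hzero _ (quarter_mem_regularSet τ l)
    simpa [Xi, hb] using this
  -- All coefficients vanish at `E`, so `X - E` would be a common divisor.
  exact Polynomial.not_isUnit_X_sub_C E (hξ.coprime _ (Polynomial.dvd_iff_isRoot.2 hc)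
    fun i j => Polynomial.dvd_iff_isRoot.2 (hb i j))

/-- An accumulation point of zeros in `K` would make `Ξ(·, E)` vanish on the whole connected regular
set. -/
theorem finite_zeros_Xi {τ : UpperHalfPlane} {l : Fin 4 → ℕ} {ξ : XiCoeffs l} (hξ : IsXi τ ξ)
    (E : ℂ) {K : Set ℂ} (hK : IsCompact K) (hKD : K ⊆ regularSet τ l) :
    {x ∈ K | Xi τ ξ x E = 0}.Finite := by
  by_contra hinf
  obtain ⟨x, hx, hacc⟩ := Set.Infinite.exists_accPt_of_subset_isCompact hinf hK fun x hx => hx.1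
  obtain ⟨y, hy, hy0⟩ := exists_Xi_ne_zero hξ E
  refine hy0 (AnalyticOnNhd.eqOn_zero_of_preconnected_of_frequently_eq_zero
    (fun z hz => analyticAt_Xi ξ E hz) (isPreconnected_regularSet τ l) (hKD hx) ?_ hy)
  exact (accPt_iff_frequently_nhdsNE.1 hacc).mono fun z hz => hz.2

/-! ### Integrals over a horizontal period and the independence of `Q₁` from the segment. -/

theorem integral_deriv_eq_zero_of_periodic {H h : ℂ → ℂ} {b : ℂ}
    (hH : ∀ t ∈ Set.Icc (0 : ℝ) 1, HasDerivAt H (h (b + t)) (b + t))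
    (hh : ContinuousOn (fun t : ℝ => h (b + t)) (Set.Icc 0 1)) (hper : H (b + 1) = H b) :
    ∫ t in (0 : ℝ)..1, h (b + t) = 0 := by
  have := intervalIntegral.integral_eq_sub_of_hasDerivAt (a := (0 : ℝ)) (b := 1)
    (f := fun t : ℝ => H (b + t)) (f' := fun t : ℝ => h (b + t)) (fun t ht => by
      rw [Set.uIcc_of_le zero_le_one] at ht
      exact ((hH t ht).comp_const_add b (t : ℂ)).comp_ofReal)
    (hh.intervalIntegrable_of_Icc zero_le_one)
  rw [this]
  simp [hper]

/-- The mean value over a horizontal period of a function holomorphic in a horizontal strip does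
not depend on the height. -/
theorem integral_horizontal_eq {S : Set ℂ} (hS : IsOpen S) (hSc : IsPreconnected S)
    (hSt : ∀ w ∈ S, ∀ t : ℝ, w + t ∈ S) {g : ℂ → ℂ} (hg : AnalyticOnNhd ℂ g S)
    (hg1 : ∀ w, g (w + 1) = g w) {w₁ w₂ : ℂ} (h₁ : w₁ ∈ S) (h₂ : w₂ ∈ S) :
    ∫ t in (0 : ℝ)..1, g (w₁ + t) = ∫ t in (0 : ℝ)..1, g (w₂ + t) := by
  have hmap : Set.MapsTo (fun p : ℂ × ℝ => p.1 + p.2) (S ×ˢ Set.Icc 0 1) S := fun p hp =>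
    hSt _ hp.1 _
  have hc : ContinuousOn (fun p : ℂ × ℝ => p.1 + (p.2 : ℂ)) (S ×ˢ Set.Icc 0 1) := by fun_prop
  have hd : ∀ w ∈ S, HasDerivAt (fun w => ∫ t in (0 : ℝ)..1, g (w + t)) 0 w := by
    intro w hw
    have hz : ∫ t in (0 : ℝ)..1, deriv g (w + t) = 0 :=
      integral_deriv_eq_zero_of_periodic (fun t _ => (hg _ (hSt w hw t)).differentiableAt.hasDerivAt)
        (hg.deriv.continuousOn.comp (by fun_prop) fun t _ => hSt w hw t) (hg1 w)
    rw [← hz]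
    exact hasDerivAt_integral_of_continuousOn hS hw (hg.continuousOn.comp hc hmap)
      (F' := fun w t => deriv g (w + t))
      (hg.deriv.continuousOn.comp hc hmap) fun e he t _ =>
      (hg _ (hSt e he t)).differentiableAt.hasDerivAt.comp_add_const e _
  exact hS.is_const_of_deriv_eq_zero hSc (fun z hz => (hd z hz).differentiableAt.differentiableWithinAt)
      (fun z hz => (hd z hz).deriv) h₁ h₂

theorem im_ne_of_notMem_lattice {τ : UpperHalfPlane} {w : ℂ}
    (hw : ∀ t ∈ Set.Icc (0 : ℝ) 1, w + t ∉ (periods τ).lattice) (n : ℤ) : w.im ≠ n * τ.im := by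
  intro h
  -- This `t` makes the real part of `w + t` differ from `n Re τ` by an integer, so `w + t` would be
  -- a lattice point.
  refine hw (Int.fract (-w.re + n * (τ : ℂ).re)) ⟨Int.fract_nonneg _, (Int.fract_lt_one _).le⟩
    (PeriodPair.mem_lattice.2 ⟨-⌊-w.re + n * (τ : ℂ).re⌋, n, ?_⟩)
  change ((_ : ℤ) : ℂ) * 1 + (n : ℂ) * (τ : ℂ) = _
  apply Complex.ext
  · have := Int.self_sub_floor (-w.re + n * τ.re)
    simp
    linarith
  · simpa using h.symm

theorem exists_sub_mem_strip {τ : UpperHalfPlane} {w : ℂ} (hw : ∀ n : ℤ, w.im ≠ n * τ.im) :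
    ∃ n : ℤ, (w - n * (τ : ℂ)).im ∈ Set.Ioo 0 τ.im := by
  have hτ := τ.im_pos
  refine ⟨⌊w.im / τ.im⌋, ?_⟩
  have h1 := Int.floor_le (w.im / τ.im)
  have h2 := Int.lt_floor_add_one (w.im / τ.im)
  rw [le_div_iff₀ hτ] at h1
  rw [div_lt_iff₀ hτ] at h2
  have h3 := hw ⌊w.im / τ.im⌋
  have h4 : (w - (⌊w.im / τ.im⌋ : ℂ) * (τ : ℂ)).im = w.im - ⌊w.im / τ.im⌋ * τ.im := by simp
  rw [h4]
  constructor
  · have := lt_of_le_of_ne h1 h3.symm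
    linarith
  · linarith

/-- Translating by multiples of `τ` brings both segments into the pole-free strip `0 < Im < Im τ`,
so poles lying between the original segments do not matter. -/
theorem integral_weierstrassP_pow_eq {τ : UpperHalfPlane} {w₁ w₂ : ℂ}
    (h₁ : ∀ t ∈ Set.Icc (0 : ℝ) 1, w₁ + t ∉ (periods τ).lattice)
    (h₂ : ∀ t ∈ Set.Icc (0 : ℝ) 1, w₂ + t ∉ (periods τ).lattice) (k : ℕ) :
    ∫ t in (0 : ℝ)..1, (periods τ).weierstrassP (w₁ + t) ^ k =
      ∫ t in (0 : ℝ)..1, (periods τ).weierstrassP (w₂ + t) ^ k := by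
  have hper : ∀ ω ∈ (periods τ).lattice, ∀ z, (periods τ).weierstrassP (z + ω) =
      (periods τ).weierstrassP z := fun ω hω z => (periods τ).weierstrassP_add_coe z ⟨ω, hω⟩
  set S : Set ℂ := {w | w.im ∈ Set.Ioo 0 τ.im} with hSdef
  have hSopen : IsOpen S := isOpen_Ioo.preimage Complex.continuous_im
  have hSconv : Convex ℝ S := (convex_Ioo 0 τ.im).linear_preimage Complex.imLm
  have hSlat : ∀ w ∈ S, w ∉ (periods τ).lattice := by
    intro w hw hmem
    obtain ⟨m, n, hmn⟩ := PeriodPair.mem_lattice.mp hmem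
    change (m : ℂ) * 1 + (n : ℂ) * (τ : ℂ) = _ at hmn
    have him := congrArg Complex.im hmn
    simp at him
    obtain ⟨h0, h1⟩ := hw
    rw [← him] at h0 h1
    have hτ := τ.im_pos
    have hn0 : (0 : ℝ) < n := pos_of_mul_pos_left h0 hτ.le
    have hn1 : (n : ℝ) < 1 := by
      by_contra! hle
      nlinarith
    have : 0 < n := by exact_mod_cast hn0
    have : n < 1 := by exact_mod_cast hn1
    omega
  have hshift : ∀ w, ∀ n : ℤ, ∫ t in (0 : ℝ)..1, (periods τ).weierstrassP (w + t) ^ k =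
      ∫ t in (0 : ℝ)..1, (periods τ).weierstrassP (w - n * (τ : ℂ) + t) ^ k := by
    intro w n
    have hn : (n : ℂ) * (τ : ℂ) ∈ (periods τ).lattice := by
      simpa using (periods τ).lattice.smul_mem n (tau_mem_lattice τ)
    congr 1
    funext t
    rw [← hper _ hn (w - n * (τ : ℂ) + t)]
    congr 2
    ring
  obtain ⟨n₁, hn₁⟩ := exists_sub_mem_strip (im_ne_of_notMem_lattice h₁)
  obtain ⟨n₂, hn₂⟩ := exists_sub_mem_strip (im_ne_of_notMem_lattice h₂)
  rw [hshift w₁ n₁, hshift w₂ n₂]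
  exact integral_horizontal_eq (g := fun w => (periods τ).weierstrassP w ^ k) hSopen
    hSconv.isPreconnected (fun w hw t => by simpa [hSdef] using hw)
    (fun w hw => ((periods τ).analyticOnNhd_weierstrassP w (hSlat w hw)).pow k)
    (fun w => by simp only [hper 1 (one_mem_lattice τ)]) hn₁ hn₂

/-- `Q₁` does not depend on the horizontal segment. -/
theorem Q₁_eq_Q₁ {τ : UpperHalfPlane} {l : Fin 4 → ℕ} (ξ : XiCoeffs l) {ε₁ ε₂ : ℂ}
    (h₁ : ∀ t ∈ Set.Icc (0 : ℝ) 1, ε₁ + t ∈ regularSet τ l)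
    (h₂ : ∀ t ∈ Set.Icc (0 : ℝ) 1, ε₂ + t ∈ regularSet τ l) (E : ℂ) :
    Q₁ τ ξ ε₁ E = Q₁ τ ξ ε₂ E := by
  -- The sum is split because each shifted `℘` needs its own translation into the strip.
  have hsum : ∀ ε : ℂ, (∀ t ∈ Set.Icc (0 : ℝ) 1, ε + t ∈ regularSet τ l) →
      Q₁ τ ξ ε E = ξ.c.eval E + ∑ i, ∑ j : Fin (l i), (ξ.b i j).eval E *
        ∫ t in (0 : ℝ)..1, (periods τ).weierstrassP (ε + halfPeriod τ i + t) ^ (l i - (j : ℕ)) := by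
    intro ε hε
    have hcont : ∀ i, ∀ j : Fin (l i), IntervalIntegrable (fun t : ℝ => (ξ.b i j).eval E *
        wp τ i (ε + t) ^ (l i - (j : ℕ))) MeasureTheory.volume 0 1 := by
      intro i j
      refine ContinuousOn.intervalIntegrable_of_Icc zero_le_one fun t ht => ?_
      exact (continuousAt_const.mul ((analyticAt_wp_pow (hε t ht) i j).continuousAt.comp
        (f := fun t : ℝ => ε + (t : ℂ)) (by fun_prop))).continuousWithinAt
    have hcont' : ∀ i, IntervalIntegrable (fun t : ℝ => ∑ j : Fin (l i), (ξ.b i j).eval E *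
        wp τ i (ε + t) ^ (l i - (j : ℕ))) MeasureTheory.volume 0 1 := fun i => by
      simpa [Finset.sum_fn] using IntervalIntegrable.sum Finset.univ fun j _ => hcont i j
    unfold Q₁ Xi
    rw [intervalIntegral.integral_add intervalIntegrable_const (by
      simpa [Finset.sum_fn] using IntervalIntegrable.sum Finset.univ fun i _ => hcont' i),
      intervalIntegral.integral_finsetSum fun i _ => hcont' i]
    congr 1
    · simp
    · refine Finset.sum_congr rfl fun i _ => ?_
      rw [intervalIntegral.integral_finsetSum fun j _ => hcont i j]
      refine Finset.sum_congr rfl fun j _ => ?_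
      rw [intervalIntegral.integral_const_mul]
      simp only [wp, add_right_comm]
  rw [hsum ε₁ h₁, hsum ε₂ h₂]
  congr 1
  refine Finset.sum_congr rfl fun i _ => Finset.sum_congr rfl fun j _ => ?_
  have hi : l i ≠ 0 := by have := j.2; omega
  congr 1
  exact integral_weierstrassP_pow_eq
    (fun t ht => by rw [add_right_comm]; exact h₁ t ht i hi)
    (fun t ht => by rw [add_right_comm]; exact h₂ t ht i hi) _

/-! ### Variation of the period integrals with the energy. -/

variable {τ : UpperHalfPlane} {l : Fin 4 → ℕ} {b E : ℂ}

/-- The energies `E` for which `Ξ(·, E)` has no zero on the segment from `b` to `b + 1`. -/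
def nonvanishingSet (τ : UpperHalfPlane) {l : Fin 4 → ℕ} (ξ : XiCoeffs l) (b : ℂ) : Set ℂ :=
  {E | ∀ t ∈ Set.Icc (0 : ℝ) 1, Xi τ ξ (b + t) E ≠ 0}

theorem continuousOn_iteratedDeriv_Xi_segment (ξ : XiCoeffs l)
    (hb : ∀ t ∈ Set.Icc (0 : ℝ) 1, b + t ∈ regularSet τ l) (n : ℕ) (V : Set ℂ) :
    ContinuousOn (fun p : ℂ × ℝ => iteratedDeriv n (fun z => Xi τ ξ z p.1) (b + p.2))
      (V ×ˢ Set.Icc 0 1) :=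
  (continuousOn_iteratedDeriv_Xi (τ := τ) ξ n).comp
    (f := fun p : ℂ × ℝ => (b + (p.2 : ℂ), p.1)) (by fun_prop)
    fun p hp => ⟨hb p.2 hp.2, Set.mem_univ _⟩

theorem continuousOn_iteratedDeriv_Xi_line (ξ : XiCoeffs l)
    (hb : ∀ t ∈ Set.Icc (0 : ℝ) 1, b + t ∈ regularSet τ l) (n : ℕ) (E : ℂ) :
    ContinuousOn (fun t : ℝ => iteratedDeriv n (fun z => Xi τ ξ z E) (b + t)) (Set.Icc 0 1) :=
  fun t ht => ((analyticAt_iteratedDeriv_Xi ξ n (hb t ht) E).continuousAt.comp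
    (f := fun t : ℝ => b + (t : ℂ)) (by fun_prop)).continuousWithinAt

theorem isOpen_nonvanishingSet (ξ : XiCoeffs l)
    (hb : ∀ t ∈ Set.Icc (0 : ℝ) 1, b + t ∈ regularSet τ l) :
    IsOpen (nonvanishingSet τ ξ b) := by
  refine isOpen_iff_mem_nhds.2 fun E hE => ?_
  refine isCompact_Icc.eventually_forall_of_forall_eventually fun t ht => ?_
  have hc := (continuousOn_iteratedDeriv_Xi (τ := τ) ξ 0).continuousAt
    (((isOpen_regularSet τ l).prod isOpen_univ).mem_nhds
      (show (b + (t : ℂ), E) ∈ _ from ⟨hb t ht, Set.mem_univ _⟩))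
  simp only [iteratedDeriv_zero] at hc
  have : ContinuousAt (fun p : ℂ × ℝ => Xi τ ξ (b + p.2) p.1) (E, t) :=
    hc.comp_of_eq (f := fun p : ℂ × ℝ => (b + (p.2 : ℂ), p.1)) (by fun_prop) rfl
  exact this.eventually_ne (hE t ht)

/-- `∂_E (Ξ'/Ξ) = ∂_x (Ξ_E/Ξ)`, and `Ξ_E/Ξ` has period 1. -/
theorem hasDerivAt_integral_logDeriv (ξ : XiCoeffs l)
    (hb : ∀ t ∈ Set.Icc (0 : ℝ) 1, b + t ∈ regularSet τ l) (hE : E ∈ nonvanishingSet τ ξ b) :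
    HasDerivAt (fun E => ∫ t in (0 : ℝ)..1,
      deriv (fun z => Xi τ ξ z E) (b + t) / Xi τ ξ (b + t) E) 0 E := by
  simp only [← iteratedDeriv_one]
  have hf := continuousOn_iteratedDeriv_Xi_segment ξ hb 0 (nonvanishingSet τ ξ b)
  have hf1 := continuousOn_iteratedDeriv_Xi_segment ξ hb 1 (nonvanishingSet τ ξ b)
  have hg := continuousOn_iteratedDeriv_Xi_segment ξ.derivative hb 0 (nonvanishingSet τ ξ b)
  have hg1 := continuousOn_iteratedDeriv_Xi_segment ξ.derivative hb 1 (nonvanishingSet τ ξ b)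
  simp only [iteratedDeriv_zero] at hf hg
  have hne : ∀ p ∈ nonvanishingSet τ ξ b ×ˢ Set.Icc (0 : ℝ) 1, Xi τ ξ (b + p.2) p.1 ≠ 0 :=
    fun p hp => hp.1 p.2 hp.2
  have key := hasDerivAt_integral_of_continuousOn (isOpen_nonvanishingSet ξ hb) hE
    (F := fun E t => iteratedDeriv 1 (fun z => Xi τ ξ z E) (b + t) / Xi τ ξ (b + t) E)
    (F' := fun E t => (iteratedDeriv 1 (fun z => Xi τ ξ.derivative z E) (b + t) * Xi τ ξ (b + t) E -
      iteratedDeriv 1 (fun z => Xi τ ξ z E) (b + t) * Xi τ ξ.derivative (b + t) E) /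
        Xi τ ξ (b + t) E ^ 2)
    (hf1.div hf hne) (((hg1.mul hf).sub (hf1.mul hg)).div (hf.pow 2) fun p hp =>
      pow_ne_zero 2 (hne p hp)) (fun e he t ht => by
      have h0 := hasDerivAt_iteratedDeriv_Xi_energy ξ 0 (hb t ht) e
      simp only [iteratedDeriv_zero] at h0
      exact (hasDerivAt_iteratedDeriv_Xi_energy ξ 1 (hb t ht) e).div h0 (he t ht))
  convert! key using 1
  refine (integral_deriv_eq_zero_of_periodic
    (H := fun x => Xi τ ξ.derivative x E / Xi τ ξ x E) (h := fun x =>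
      (iteratedDeriv 1 (fun z => Xi τ ξ.derivative z E) x * Xi τ ξ x E -
      iteratedDeriv 1 (fun z => Xi τ ξ z E) x * Xi τ ξ.derivative x E) / Xi τ ξ x E ^ 2)
    (fun t ht => ?_) ?_ ?_).symm
  · have h0 := hasDerivAt_iteratedDeriv_Xi ξ 0 (hb t ht) E
    have h1 := hasDerivAt_iteratedDeriv_Xi ξ.derivative 0 (hb t ht) E
    simp only [iteratedDeriv_zero, zero_add] at h0 h1
    convert! h1.div h0 (hE t ht) using 1
    ring
  · have := continuousOn_iteratedDeriv_Xi_line ξ hb 0 E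
    have := continuousOn_iteratedDeriv_Xi_line ξ.derivative hb 0 E
    simp only [iteratedDeriv_zero] at *
    have := continuousOn_iteratedDeriv_Xi_line ξ hb 1 E
    have := continuousOn_iteratedDeriv_Xi_line ξ.derivative hb 1 E
    refine ContinuousOn.div (by fun_prop) (by fun_prop) fun t ht => pow_ne_zero 2 (hE t ht)
  · simp only [Xi_add_one]

theorem hasDerivAt_integral_inv (ξ : XiCoeffs l)
    (hb : ∀ t ∈ Set.Icc (0 : ℝ) 1, b + t ∈ regularSet τ l) (hE : E ∈ nonvanishingSet τ ξ b) :
    HasDerivAt (fun E => ∫ t in (0 : ℝ)..1, (Xi τ ξ (b + t) E)⁻¹)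
      (∫ t in (0 : ℝ)..1, -Xi τ ξ.derivative (b + t) E / Xi τ ξ (b + t) E ^ 2) E := by
  have hf := continuousOn_iteratedDeriv_Xi_segment ξ hb 0 (nonvanishingSet τ ξ b)
  have hg := continuousOn_iteratedDeriv_Xi_segment ξ.derivative hb 0 (nonvanishingSet τ ξ b)
  simp only [iteratedDeriv_zero] at hf hg
  have hne : ∀ p ∈ nonvanishingSet τ ξ b ×ˢ Set.Icc (0 : ℝ) 1, Xi τ ξ (b + p.2) p.1 ≠ 0 :=
    fun p hp => hp.1 p.2 hp.2
  exact hasDerivAt_integral_of_continuousOn (isOpen_nonvanishingSet ξ hb) hE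
    (F := fun E t => (Xi τ ξ (b + t) E)⁻¹)
    (F' := fun E t => -Xi τ ξ.derivative (b + t) E / Xi τ ξ (b + t) E ^ 2)
    (hf.inv₀ hne) (hg.neg.div (hf.pow 2) fun p hp => pow_ne_zero 2 (hne p hp))
    (fun e he t ht => by
      have h0 := hasDerivAt_iteratedDeriv_Xi_energy ξ 0 (hb t ht) e
      simp only [iteratedDeriv_zero] at h0
      exact h0.inv (he t ht))

theorem hasDerivAt_QExpr_energy (ξ : XiCoeffs l) {x : ℂ} (hx : x ∈ regularSet τ l) (E : ℂ) :
    HasDerivAt (fun E => QExpr τ ξ x E)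
      (2 * Xi τ ξ x E * Xi τ ξ.derivative x E * (E - potential τ l x) + Xi τ ξ x E ^ 2 +
        1 / 2 * (Xi τ ξ.derivative x E * iteratedDeriv 2 (fun z => Xi τ ξ z E) x +
          Xi τ ξ x E * iteratedDeriv 2 (fun z => Xi τ ξ.derivative z E) x) -
        1 / 2 * (iteratedDeriv 1 (fun z => Xi τ ξ z E) x *
          iteratedDeriv 1 (fun z => Xi τ ξ.derivative z E) x)) E := by
  have h0 := hasDerivAt_iteratedDeriv_Xi_energy ξ 0 hx E
  have h1 := hasDerivAt_iteratedDeriv_Xi_energy ξ 1 hx E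
  have h2 := hasDerivAt_iteratedDeriv_Xi_energy ξ 2 hx E
  simp only [iteratedDeriv_zero] at h0
  unfold QExpr
  simp only [← iteratedDeriv_one]
  convert! (((h0.pow 2).mul ((hasDerivAt_id E).sub_const (potential τ l x))).add
    ((h0.const_mul (1 / 2 : ℂ)).mul h2)).sub ((h1.pow 2).const_mul (1 / 4 : ℂ)) using 1
  simp only [Pi.pow_apply, id]
  ring

theorem differentiable_Q (ξ : XiCoeffs l) : Differentiable ℂ (Q τ ξ) := fun E =>
  (hasDerivAt_QExpr_energy ξ (quarter_mem_regularSet τ l) E).differentiableAt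

theorem deriv_Q {ξ : XiCoeffs l} (hξ : IsXi τ ξ) {x : ℂ} (hx : x ∈ regularSet τ l) (E : ℂ) :
    deriv (Q τ ξ) E =
      2 * Xi τ ξ x E * Xi τ ξ.derivative x E * (E - potential τ l x) + Xi τ ξ x E ^ 2 +
        1 / 2 * (Xi τ ξ.derivative x E * iteratedDeriv 2 (fun z => Xi τ ξ z E) x +
          Xi τ ξ x E * iteratedDeriv 2 (fun z => Xi τ ξ.derivative z E) x) -
        1 / 2 * (iteratedDeriv 1 (fun z => Xi τ ξ z E) x *
          iteratedDeriv 1 (fun z => Xi τ ξ.derivative z E) x) := by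
  rw [← (hasDerivAt_QExpr_energy ξ hx E).deriv]
  congr 1
  funext E
  exact (QExpr_eq_Q hξ hx E).symm

/-- The relation between the periods `∫ Ξ` and `∂/∂E ∫ √(-Q) / Ξ`. -/
theorem Q_mul_integral_sub_eq {ξ : XiCoeffs l} (hξ : IsXi τ ξ)
    (hb : ∀ t ∈ Set.Icc (0 : ℝ) 1, b + t ∈ regularSet τ l) (hE : E ∈ nonvanishingSet τ ξ b) :
    -Q τ ξ E * (∫ t in (0 : ℝ)..1, -Xi τ ξ.derivative (b + t) E / Xi τ ξ (b + t) E ^ 2) -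
      deriv (Q τ ξ) E / 2 * (∫ t in (0 : ℝ)..1, (Xi τ ξ (b + t) E)⁻¹) =
      -(1 / 2) * Q₁ τ ξ b E := by
  have hf := continuousOn_iteratedDeriv_Xi_line ξ hb 0 E
  have hf1 := continuousOn_iteratedDeriv_Xi_line ξ hb 1 E
  have hf2 := continuousOn_iteratedDeriv_Xi_line ξ hb 2 E
  have hg := continuousOn_iteratedDeriv_Xi_line ξ.derivative hb 0 E
  have hg1 := continuousOn_iteratedDeriv_Xi_line ξ.derivative hb 1 E
  have hg2 := continuousOn_iteratedDeriv_Xi_line ξ.derivative hb 2 E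
  simp only [iteratedDeriv_zero] at hf hg
  have hne2 : ∀ t ∈ Set.Icc (0 : ℝ) 1, Xi τ ξ (b + t) E ^ 2 ≠ 0 := fun t ht =>
    pow_ne_zero 2 (hE t ht)
  -- `h` is the x-derivative of the periodic function `Ξ' Ξ_E/Ξ - Ξ_E'`. Pointwise, the integrand on
  -- the left of the claim is `-Ξ/2 + h/4`.
  set h : ℂ → ℂ := fun x =>
    iteratedDeriv 2 (fun z => Xi τ ξ z E) x * Xi τ ξ.derivative x E / Xi τ ξ x E +
      iteratedDeriv 1 (fun z => Xi τ ξ z E) x *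
        iteratedDeriv 1 (fun z => Xi τ ξ.derivative z E) x / Xi τ ξ x E -
      iteratedDeriv 1 (fun z => Xi τ ξ z E) x ^ 2 * Xi τ ξ.derivative x E / Xi τ ξ x E ^ 2 -
      iteratedDeriv 2 (fun z => Xi τ ξ.derivative z E) x with hh
  have hhc : ContinuousOn (fun t : ℝ => h (b + t)) (Set.Icc 0 1) :=
    (((((hf2.mul hg).div hf hE).add ((hf1.mul hg1).div hf hE))).sub
      (((hf1.pow 2).mul hg).div (hf.pow 2) hne2)).sub hg2
  have hzero : ∫ t in (0 : ℝ)..1, h (b + t) = 0 := by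
    refine integral_deriv_eq_zero_of_periodic (H := fun x =>
      iteratedDeriv 1 (fun z => Xi τ ξ z E) x * Xi τ ξ.derivative x E / Xi τ ξ x E -
        iteratedDeriv 1 (fun z => Xi τ ξ.derivative z E) x) (fun t ht => ?_) hhc ?_
    · have h0 := hasDerivAt_iteratedDeriv_Xi ξ 0 (hb t ht) E
      have h1 := hasDerivAt_iteratedDeriv_Xi ξ 1 (hb t ht) E
      have k0 := hasDerivAt_iteratedDeriv_Xi ξ.derivative 0 (hb t ht) E
      have k1 := hasDerivAt_iteratedDeriv_Xi ξ.derivative 1 (hb t ht) E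
      simp only [iteratedDeriv_zero, zero_add] at h0 k0
      have hfne := hE t ht
      convert! ((h1.mul k0).div h0 hfne).sub k1 using 1
      simp only [hh, Pi.mul_apply]
      field_simp
    · simp only [Xi_add_one, iteratedDeriv_Xi_add_one]
  have hint : ∀ {F : ℝ → ℂ}, ContinuousOn F (Set.Icc 0 1) →
      IntervalIntegrable F MeasureTheory.volume 0 1 := fun hF =>
    hF.intervalIntegrable_of_Icc zero_le_one
  have i1 : IntervalIntegrable (fun t : ℝ => -(1 / 2) * Xi τ ξ (b + t) E)
      MeasureTheory.volume 0 1 := hint (continuousOn_const.mul hf)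
  have i2 : IntervalIntegrable (fun t : ℝ => 1 / 4 * h (b + t)) MeasureTheory.volume 0 1 :=
    hint (continuousOn_const.mul hhc)
  have i3 : IntervalIntegrable (fun t : ℝ => -Q τ ξ E *
      (-Xi τ ξ.derivative (b + t) E / Xi τ ξ (b + t) E ^ 2)) MeasureTheory.volume 0 1 :=
    hint (continuousOn_const.mul (hg.neg.div (hf.pow 2) hne2))
  have i4 : IntervalIntegrable (fun t : ℝ => deriv (Q τ ξ) E / 2 * (Xi τ ξ (b + t) E)⁻¹)
      MeasureTheory.volume 0 1 := hint (continuousOn_const.mul (hf.inv₀ hE))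
  have e1 : -(1 / 2) * Q₁ τ ξ b E =
      ∫ t in (0 : ℝ)..1, (-(1 / 2) * Xi τ ξ (b + t) E + 1 / 4 * h (b + t)) := by
    rw [intervalIntegral.integral_add i1 i2, intervalIntegral.integral_const_mul,
      intervalIntegral.integral_const_mul, hzero, mul_zero, add_zero, Q₁]
  rw [e1, ← intervalIntegral.integral_const_mul, ← intervalIntegral.integral_const_mul,
    ← intervalIntegral.integral_sub i3 i4]
  refine intervalIntegral.integral_congr fun t ht => ?_
  rw [Set.uIcc_of_le zero_le_one] at ht
  have hfne := hE t ht
  simp only [hh]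
  rw [deriv_Q hξ (hb t ht) E, ← QExpr_eq_Q hξ (hb t ht) E, QExpr, ← iteratedDeriv_one]
  field_simp
  ring

/-! ### The multiplier of the shift. -/

variable {s : ℂ} {U : Set ℂ}

/-- The factor by which `Λ(·, E)` changes along the segment from `b` to `b + 1`. -/
def multiplier (τ : UpperHalfPlane) {l : Fin 4 → ℕ} (ξ : XiCoeffs l) (b E s : ℂ) : ℂ :=
  Complex.exp (∫ t in (0 : ℝ)..1,
    (deriv (fun z => Xi τ ξ z E) (b + t) / 2 + s) / Xi τ ξ (b + t) E)

theorem multiplier_eq_exp (ξ : XiCoeffs l)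
    (hb : ∀ t ∈ Set.Icc (0 : ℝ) 1, b + t ∈ regularSet τ l) (hE : E ∈ nonvanishingSet τ ξ b)
    (s : ℂ) : multiplier τ ξ b E s = Complex.exp
      (1 / 2 * (∫ t in (0 : ℝ)..1, deriv (fun z => Xi τ ξ z E) (b + t) / Xi τ ξ (b + t) E) +
        s * ∫ t in (0 : ℝ)..1, (Xi τ ξ (b + t) E)⁻¹) := by
  have hf := continuousOn_iteratedDeriv_Xi_line ξ hb 0 E
  have hf1 := continuousOn_iteratedDeriv_Xi_line ξ hb 1 E
  simp only [iteratedDeriv_zero, iteratedDeriv_one] at hf hf1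
  have i1 : IntervalIntegrable (fun t : ℝ =>
      1 / 2 * (deriv (fun z => Xi τ ξ z E) (b + t) / Xi τ ξ (b + t) E))
      MeasureTheory.volume 0 1 :=
    (continuousOn_const.mul (hf1.div hf hE)).intervalIntegrable_of_Icc zero_le_one
  have i2 : IntervalIntegrable (fun t : ℝ => s * (Xi τ ξ (b + t) E)⁻¹)
      MeasureTheory.volume 0 1 :=
    (continuousOn_const.mul (hf.inv₀ hE)).intervalIntegrable_of_Icc zero_le_one
  rw [multiplier, ← intervalIntegral.integral_const_mul, ← intervalIntegral.integral_const_mul,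
    ← intervalIntegral.integral_add i1 i2]
  congr 2
  funext t
  ring

theorem continuousWithinAt_multiplier (ξ : XiCoeffs l)
    (hb : ∀ t ∈ Set.Icc (0 : ℝ) 1, b + t ∈ regularSet τ l) {γ y : ℝ → ℂ} {I : Set ℝ} {t : ℝ}
    (hγ : ContinuousWithinAt γ I t) (hy : ContinuousWithinAt y I t)
    (ht : γ t ∈ nonvanishingSet τ ξ b) :
    ContinuousWithinAt (fun t => multiplier τ ξ b (γ t) (y t)) I t := by
  have hA := (hasDerivAt_integral_logDeriv ξ hb ht).continuousAt.comp_continuousWithinAt hγ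
  have hC := (hasDerivAt_integral_inv ξ hb ht).continuousAt.comp_continuousWithinAt hγ
  refine ((hA.const_mul (1 / 2)).add (hy.mul hC)).cexp.congr_of_eventuallyEq ?_
    (multiplier_eq_exp ξ hb ht _)
  filter_upwards [hγ ((isOpen_nonvanishingSet ξ hb).mem_nhds ht)] with u hu
  exact multiplier_eq_exp ξ hb hu _

/-- In the exponent only `y ∫ 1/Ξ` varies. With `y² = -Q` and `y' = -Q' γ'/(2y)`, its derivative is
`γ'/y` times the left side of `Q_mul_integral_sub_eq`. -/
theorem hasDerivAt_multiplier {ξ : XiCoeffs l} (hξ : IsXi τ ξ)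
    (hb : ∀ t ∈ Set.Icc (0 : ℝ) 1, b + t ∈ regularSet τ l) {γ y : ℝ → ℂ} {t : ℝ}
    (hγ : DifferentiableAt ℝ γ t) (hy : ContinuousAt y t)
    (hsq : ∀ᶠ u in 𝓝 t, y u ^ 2 = -Q τ ξ (γ u)) (h0 : y t ≠ 0)
    (ht : γ t ∈ nonvanishingSet τ ξ b) :
    HasDerivAt (fun t => multiplier τ ξ b (γ t) (y t))
      (-(1 / 2) * (Q₁ τ ξ b (γ t) / y t * deriv γ t) * multiplier τ ξ b (γ t) (y t)) t := by
  have hA := (hasDerivAt_integral_logDeriv ξ hb ht).comp t hγ.hasDerivAt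
  have hC := (hasDerivAt_integral_inv ξ hb ht).comp t hγ.hasDerivAt
  have hQ := ((differentiable_Q (τ := τ) ξ (γ t)).hasDerivAt.comp t hγ.hasDerivAt).neg
  have hY := hasDerivAt_of_sq_eq hQ hy hsq h0
  have key := ((hA.const_mul (1 / 2)).add (hY.mul hC)).cexp.congr_of_eventuallyEq
    (f₁ := fun t => multiplier τ ξ b (γ t) (y t)) (by
      filter_upwards [hγ.continuousAt ((isOpen_nonvanishingSet ξ hb).mem_nhds ht)] with u hu
      exact multiplier_eq_exp ξ hb hu _)
  convert! key using 1
  have hrel := Q_mul_integral_sub_eq hξ hb ht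
  rw [← hsq.self_of_nhds] at hrel
  rw [multiplier_eq_exp ξ hb ht, mul_comm]
  congr 1
  have hrel' : -(1 / 2) * (Q₁ τ ξ b (γ t) / y t * deriv γ t) =
      (-(1 / 2) * Q₁ τ ξ b (γ t)) / y t * deriv γ t := by ring
  rw [hrel', ← hrel]
  simp only [Function.comp_apply]
  field_simp
  ring

theorem analyticOnNhd_Xi (ξ : XiCoeffs l) (hU : U ⊆ regularSet τ l) (E : ℂ) :
    AnalyticOnNhd ℂ (fun z => Xi τ ξ z E) U := fun _ hz => analyticAt_Xi ξ E (hU hz)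

theorem deriv_Xi_add_one (ξ : XiCoeffs l) (E z : ℂ) :
    deriv (fun z => Xi τ ξ z E) (z + 1) = deriv (fun z => Xi τ ξ z E) z := by
  simpa only [iteratedDeriv_one] using iteratedDeriv_Xi_add_one ξ 1 z E

theorem IsLambda.ne_zero {ξ : XiCoeffs l} {Λ : ℂ → ℂ} (hΛ : IsLambda τ ξ U E s Λ) {x : ℂ}
    (hx : x ∈ U) (h0 : Xi τ ξ x E ≠ 0) : Λ x ≠ 0 := by
  obtain ⟨r, F, _, h⟩ := hΛ.form x hx h0
  obtain ⟨h1, _, h2⟩ := h.self_of_nhds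
  rw [h2]
  refine mul_ne_zero (fun hr => h0 ?_) (Complex.exp_ne_zero _)
  rw [← h1, hr, zero_pow two_ne_zero]

/-- Since `r² = Ξ`, the logarithmic derivative of `r exp F` is `Ξ'/(2Ξ) + s/Ξ`. -/
theorem IsLambda.deriv_mul {ξ : XiCoeffs l} {Λ : ℂ → ℂ} (hΛ : IsLambda τ ξ U E s Λ) {x : ℂ}
    (hx : x ∈ U) (h0 : Xi τ ξ x E ≠ 0) :
    deriv Λ x * Xi τ ξ x E = (deriv (fun z => Xi τ ξ z E) x / 2 + s) * Λ x := by
  obtain ⟨r, F, hr, h⟩ := hΛ.form x hx h0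
  have hrd := hr.differentiableAt.hasDerivAt
  have hsq : (fun z => Xi τ ξ z E) =ᶠ[𝓝 x] fun z => r z ^ 2 := h.mono fun z hz => hz.1.symm
  have hprod : Λ =ᶠ[𝓝 x] fun z => r z * Complex.exp (F z) := h.mono fun z hz => hz.2.2
  obtain ⟨h1, hF, h2⟩ := h.self_of_nhds
  rw [hsq.deriv_eq, hprod.deriv_eq, (hrd.fun_mul hF.cexp).deriv, (hrd.fun_pow 2).deriv, h2]
  rw [← h1] at h0 ⊢
  have hr0 : r x ≠ 0 := fun h => h0 (by rw [h, zero_pow two_ne_zero])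
  field_simp
  ring

theorem IsLambda.shift_eq {ξ : XiCoeffs l} (hU : IsShiftDomain τ l U) {Λ : ℂ → ℂ}
    (hΛ : IsLambda τ ξ U E s Λ) (hb : ∀ t ∈ Set.Icc (0 : ℝ) 1, b + t ∈ U)
    (hE : E ∈ nonvanishingSet τ ξ b) {z : ℂ} (hz : z ∈ U) :
    Λ (z + 1) = Λ z * multiplier τ ξ b E s := by
  have hA := analyticOnNhd_Xi ξ hU.subset E
  exact shift_eq_mul_exp (f := fun z => Xi τ ξ z E)
    (N := fun z => deriv (fun z => Xi τ ξ z E) z / 2 + s) hU.isOpen hU.isOpen hU.isPreconnected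
    subset_rfl hU.shift hΛ.analytic (fun _ hz => hΛ.ne_zero hz)
    (fun _ hz => hΛ.deriv_mul hz) hA.continuousOn
    ((hA.deriv.continuousOn.div_const 2).add continuousOn_const) (fun z => Xi_add_one ξ z E)
    (fun z => by simp only [deriv_Xi_add_one]) (by simpa using hb 0 (by simp)) hb hE hz

/-- The squared factor is `exp ∫ Ξ'/Ξ`. This is the shift factor of `Ξ`, viewed as a solution of `Ξ
Λ' = Ξ' Λ`, and `Ξ` is periodic. -/
theorem multiplier_zero_sq {ξ : XiCoeffs l} (hU : IsShiftDomain τ l U)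
    (hb : ∀ t ∈ Set.Icc (0 : ℝ) 1, b + t ∈ U) (hE : E ∈ nonvanishingSet τ ξ b) :
    multiplier τ ξ b E 0 ^ 2 = 1 := by
  have hA := analyticOnNhd_Xi ξ hU.subset E
  have hbU : b ∈ U := by simpa using hb 0 (by simp)
  have h0 : Xi τ ξ b E ≠ 0 := by simpa using hE 0 (by simp)
  have h := shift_eq_mul_exp (f := fun z => Xi τ ξ z E) (Λ := fun z => Xi τ ξ z E)
    (N := fun z => deriv (fun z => Xi τ ξ z E) z) hU.isOpen hU.isOpen hU.isPreconnected
    subset_rfl hU.shift hA (fun _ _ h => h) (fun _ _ _ => rfl) hA.continuousOn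
    hA.deriv.continuousOn (fun z => Xi_add_one ξ z E)
    (fun z => deriv_Xi_add_one ξ E z) hbU hb hE hbU
  rw [Xi_add_one] at h
  have hexp := mul_left_cancel₀ h0 ((mul_one _).trans h)
  rw [multiplier_eq_exp ξ (fun t ht => hU.subset (hb t ht)) hE, ← Complex.exp_nat_mul]
  refine Eq.trans ?_ hexp.symm
  congr 1
  push_cast
  ring

/-- Where `Q` does not vanish, the multiplier does not depend on the horizontal segment. -/
theorem multiplier_eq_multiplier {ξ : XiCoeffs l} (hξ : IsXi τ ξ) {Ω K W : Set ℂ}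
    (hΩ : IsOpen Ω) (hconv : Convex ℝ Ω) (hΩK : Ω ⊆ K) (hK : IsCompact K)
    (hKD : K ⊆ regularSet τ l) (hW : IsOpen W) (hWc : IsPreconnected W)
    (hWΩ : ∀ b ∈ W, ∀ t ∈ Set.Icc (0 : ℝ) 1, b + t ∈ Ω)
    (hs : s ^ 2 = -Q τ ξ E) (hs0 : s ≠ 0) {b₁ b₂ : ℂ} (hb₁ : b₁ ∈ W) (hb₂ : b₂ ∈ W)
    (hE₁ : E ∈ nonvanishingSet τ ξ b₁) (hE₂ : E ∈ nonvanishingSet τ ξ b₂) :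
    multiplier τ ξ b₁ E s = multiplier τ ξ b₂ E s := by
  have hA := analyticOnNhd_Xi ξ (hΩK.trans hKD) E
  have hN : DifferentiableOn ℂ (fun z => deriv (fun z => Xi τ ξ z E) z / 2 + s) Ω :=
    (hA.deriv.differentiableOn.div_const 2).add_const s
  obtain ⟨Λ, h1, h2, h3⟩ := exists_solution hΩ hconv (finite_zeros_Xi hξ E hK hKD).toFinset
    (fun z => Xi τ ξ z E) (fun z => deriv (fun z => Xi τ ξ z E) z / 2 + s)
    hA.differentiableOn hN (fun u hu hu0 => by simpa using ⟨hΩK hu, hu0⟩) (fun u hu hu0 => by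
      have hq := QExpr_eq_Q hξ (hKD (hΩK hu)) E
      rw [QExpr, hu0] at hq
      -- At a zero of `Ξ` the formula for `Q` reduces to `-(Ξ')²/4`, so `Ξ'/2 = ±s`. The numerator
      -- `Ξ'/2 + s` is then `Ξ'` or 0, and `s ≠ 0` makes the zero simple.
      have hprod : (deriv (fun z => Xi τ ξ z E) u / 2 + s) *
          (deriv (fun z => Xi τ ξ z E) u / 2 - s) = 0 := by
        linear_combination -hs - hq
      have hsplit : deriv (fun z => Xi τ ξ z E) u / 2 + s = 0 ∨
          deriv (fun z => Xi τ ξ z E) u / 2 - s = 0 := mul_eq_zero.1 hprod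
      refine ⟨fun hd => hs0 ?_, hsplit.imp id fun h => by linear_combination -h⟩
      rw [hd] at hsplit
      simpa using hsplit)
  have hWsub : W ⊆ Ω := fun b hb => by simpa using hWΩ b hb 0 (by simp)
  have hshift : ∀ b ∈ W, E ∈ nonvanishingSet τ ξ b → ∀ z ∈ W,
      Λ (z + 1) = Λ z * multiplier τ ξ b E s := fun b hb hE z hz =>
    shift_eq_mul_exp hΩ hW hWc hWsub (fun z hz => by simpa using hWΩ z hz 1 (by simp))
      (h1.analyticOnNhd hΩ) h2 (fun z hz _ => h3 z hz) hA.continuousOn hN.continuousOn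
      (fun z => Xi_add_one ξ z E) (fun z => by simp only [deriv_Xi_add_one]) hb (hWΩ b hb) hE hz
  have hne : Λ b₁ ≠ 0 := h2 b₁ (hWsub hb₁) (by simpa using hE₁ 0 (by simp))
  exact mul_left_cancel₀ hne ((hshift b₁ hb₁ hE₁ b₁ hb₁).symm.trans (hshift b₂ hb₂ hE₂ b₁ hb₁))

/-! ### Choice of segments and passage along the path. -/

/-- A thin thickening of a unit horizontal segment in `U`: convexity of `Ω` provides primitives,
compactness of `K` finiteness of the zeros of `Ξ`. -/
theorem IsShiftDomain.exists_convex_nhds (hU : IsShiftDomain τ l U) :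
    ∃ (a : ℂ) (δ : ℝ) (Ω K : Set ℂ), 0 < δ ∧ IsOpen Ω ∧ Convex ℝ Ω ∧ Ω ⊆ K ∧ IsCompact K ∧
      K ⊆ U ∧ ∀ b ∈ Metric.ball a δ, ∀ t ∈ Set.Icc (0 : ℝ) 1, b + t ∈ Ω := by
  obtain ⟨a, ha⟩ := hU.line
  set L : Set ℂ := (fun t : ℝ => a + t) '' Set.Icc 0 1 with hL
  have hLc : IsCompact L := isCompact_Icc.image (by fun_prop)
  have hLconv : Convex ℝ L := by
    have : L = (fun z => a + z) '' (Complex.ofRealLI.toLinearMap '' Set.Icc (0 : ℝ) 1) := by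
      rw [Set.image_image]; rfl
    rw [this]
    exact ((convex_Icc 0 1).linear_image _).translate a
  obtain ⟨δ, hδ, hsub⟩ := hLc.exists_cthickening_subset_open hU.isOpen
    (show L ⊆ U by rintro _ ⟨t, _, rfl⟩; exact ha t)
  refine ⟨a, δ, Metric.thickening δ L, Metric.cthickening δ L, hδ, Metric.isOpen_thickening,
    hLconv.thickening δ, Metric.thickening_subset_cthickening δ L, hLc.cthickening, hsub,
    fun b hb t ht => Metric.mem_thickening_iff.2 ⟨a + t, ⟨t, ht, rfl⟩, ?_⟩⟩
  simpa using hb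

/-- Infinitely many heights are available, and the finitely many zeros in `K` block only finitely
many of them. -/
theorem exists_mem_nonvanishingSet {ξ : XiCoeffs l} (hξ : IsXi τ ξ) {a : ℂ} {δ : ℝ}
    (hδ : 0 < δ) {Ω K : Set ℂ} (hΩK : Ω ⊆ K) (hK : IsCompact K) (hKD : K ⊆ regularSet τ l)
    (hΩ : ∀ b ∈ Metric.ball a δ, ∀ t ∈ Set.Icc (0 : ℝ) 1, b + t ∈ Ω) (E : ℂ) :
    ∃ b ∈ Metric.ball a δ, E ∈ nonvanishingSet τ ξ b := by
  obtain ⟨h, hh, hne⟩ := ((Set.Ioo_infinite hδ).sdiff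
    ((finite_zeros_Xi hξ E hK hKD).image fun z => z.im - a.im)).nonempty
  have hball : a + h * Complex.I ∈ Metric.ball a δ := by
    simpa [abs_of_pos hh.1] using hh.2
  refine ⟨a + h * Complex.I, hball, fun t ht h0 => hne ⟨_, ⟨hΩK (hΩ _ hball t ht), h0⟩, ?_⟩⟩
  simp

/-- The factor `σ` treats the periodic and the antiperiodic case together. -/
theorem exists_pathIntegral {ξ : XiCoeffs l} (hξ : IsXi τ ξ) {ε : ℂ}
    (hε : ∀ t : ℝ, ε + t ∈ regularSet τ l) (hU : IsShiftDomain τ l U) {E₀ : ℂ}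
    (hE₀ : Q τ ξ E₀ = 0) {Λ₀ : ℂ → ℂ} (hΛ₀ : IsLambda τ ξ U E₀ 0 Λ₀) {γ y : ℝ → ℂ}
    (hγ : IsBranchedPath τ ξ E₀ E γ y) :
    ∃ I : ℂ, HasPathIntegral τ ξ ε γ y I ∧ ∀ Λ : ℂ → ℂ, IsLambda τ ξ U E (y 1) Λ →
      ∀ σ : ℂ, (∀ x ∈ U, Λ₀ (x + 1) = σ * Λ₀ x) →
        ∀ x ∈ U, Λ (x + 1) = σ * Λ x * Complex.exp (-(1 / 2) * I) := by
  obtain ⟨a, δ, Ω, K, hδ, hΩ, hconv, hΩK, hK, hKU, hball⟩ := hU.exists_convex_nhds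
  have hKD := hKU.trans hU.subset
  have hbU : ∀ b ∈ Metric.ball a δ, ∀ t ∈ Set.Icc (0 : ℝ) 1, b + t ∈ U := fun b hb t ht =>
    hKU (hΩK (hball b hb t ht))
  have hbD : ∀ b ∈ Metric.ball a δ, ∀ t ∈ Set.Icc (0 : ℝ) 1, b + t ∈ regularSet τ l :=
    fun b hb t ht => hU.subset (hbU b hb t ht)
  -- The base point `β E` need not depend continuously on `E`. The regularity of `B` comes from
  -- `hind`, which replaces `β (γ u)` by one fixed base point for all interior `u` near a given
  -- parameter.
  choose β hβ hβE using exists_mem_nonvanishingSet hξ hδ hΩK hK hKD hball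
  set B : ℝ → ℂ := fun t => multiplier τ ξ (β (γ t)) (γ t) (y t) with hB
  have hy0 : ∀ t ∈ Set.Ioo (0 : ℝ) 1, y t ≠ 0 := fun t ht h => hγ.ne_zero t ht (by
    have := hγ.branch_sq t (Set.Ioo_subset_Icc_self ht)
    rw [h] at this
    simpa using this.symm)
  have hind : ∀ t ∈ Set.Ioo (0 : ℝ) 1, ∀ b ∈ Metric.ball a δ, γ t ∈ nonvanishingSet τ ξ b →
      B t = multiplier τ ξ b (γ t) (y t) := fun t ht b hb hbt =>
    multiplier_eq_multiplier hξ hΩ hconv hΩK hK hKD Metric.isOpen_ball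
      (convex_ball a δ).isPreconnected hball (hγ.branch_sq t (Set.Ioo_subset_Icc_self ht))
      (hy0 t ht) (hβ _) hb (hβE _) hbt
  have hopen := fun t => isOpen_nonvanishingSet ξ (hbD _ (hβ (γ t)))
  have hγc : ∀ t ∈ Set.Ioo (0 : ℝ) 1, ContinuousAt γ t := fun t ht =>
    hγ.continuousOn.continuousAt (Icc_mem_nhds ht.1 ht.2)
  have hyc : ∀ t ∈ Set.Ioo (0 : ℝ) 1, ContinuousAt y t := fun t ht =>
    hγ.branch_continuousOn.continuousAt (Icc_mem_nhds ht.1 ht.2)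
  have hder : ∀ t ∈ Set.Ioo (0 : ℝ) 1,
      HasDerivAt B (-(1 / 2) * (Q₁ τ ξ ε (γ t) / y t * deriv γ t) * B t) t := by
    intro t ht
    have h := hasDerivAt_multiplier hξ (hbD _ (hβ (γ t)))
      ((hγ.contDiffOn.differentiableOn one_ne_zero).differentiableAt (isOpen_Ioo.mem_nhds ht))
      (hyc t ht) (by
        filter_upwards [Icc_mem_nhds ht.1 ht.2] with u hu using hγ.branch_sq u hu) (hy0 t ht)
      (hβE (γ t))
    rw [Q₁_eq_Q₁ ξ (hbD _ (hβ (γ t))) (fun t _ => hε t)] at h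
    refine h.congr_of_eventuallyEq ?_
    filter_upwards [isOpen_Ioo.mem_nhds ht, hγc t ht ((hopen t).mem_nhds (hβE _))] with u hu hu'
    exact hind u hu _ (hβ _) hu'
  -- Independence of the segment may fail at an end, where `Q` can vanish. It is needed only at
  -- interior parameters near `e`, because `B e` is by definition computed with `β (γ e)`.
  have hend : ∀ e ∈ Set.Icc (0 : ℝ) 1, (∀ᶠ t in 𝓝[Set.Icc 0 1] e, t = e ∨ t ∈ Set.Ioo (0 : ℝ) 1) →
      ContinuousWithinAt B (Set.Icc 0 1) e := by
    intro e he hev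
    refine (continuousWithinAt_multiplier ξ (hbD _ (hβ (γ e))) (hγ.continuousOn e he)
      (hγ.branch_continuousOn e he) (hβE _)).congr_of_eventuallyEq ?_ rfl
    filter_upwards [hev, hγ.continuousOn e he ((hopen e).mem_nhds (hβE _))] with u hu hu'
    rcases hu with rfl | hu
    · rfl
    · exact hind u hu _ (hβ _) hu'
  have hBc : ContinuousOn B (Set.Icc 0 1) := by
    intro e he
    refine hend e he ?_
    have hmem := self_mem_nhdsWithin (s := Set.Icc (0 : ℝ) 1) (a := e)
    by_cases h : e = 1
    · filter_upwards [hmem, nhdsWithin_le_nhds (lt_mem_nhds (show (0 : ℝ) < e by simp [h]))]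
        with t ht ht0
      rcases ht.2.eq_or_lt with h1 | h1
      · exact Or.inl (h1.trans h.symm)
      · exact Or.inr ⟨ht0, h1⟩
    by_cases h' : e = 0
    · filter_upwards [hmem, nhdsWithin_le_nhds (gt_mem_nhds (show e < (1 : ℝ) by simp [h']))]
        with t ht ht1
      rcases ht.1.eq_or_lt with h1 | h1
      · exact Or.inl (h1.symm.trans h'.symm)
      · exact Or.inr ⟨h1, ht1⟩
    · filter_upwards [nhdsWithin_le_nhds (Ioo_mem_nhds (lt_of_le_of_ne he.1 (Ne.symm h'))
        (lt_of_le_of_ne he.2 h))] with t ht using Or.inr ht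
  have hQ₁ : ContinuousOn (fun t => Q₁ τ ξ ε (γ t) / y t * deriv γ t) (Set.Ioo 0 1) := by
    have hXi := fun ξ : XiCoeffs l =>
      continuousOn_iteratedDeriv_Xi_segment (τ := τ) ξ (fun t _ => hε t) 0 Set.univ
    have hd := fun e t => hasDerivAt_iteratedDeriv_Xi_energy ξ 0 (hε t) e
    simp only [iteratedDeriv_zero] at hXi hd
    have h1 : Continuous (Q₁ τ ξ ε) := continuous_iff_continuousAt.2 fun E =>
      (hasDerivAt_integral_of_continuousOn isOpen_univ (Set.mem_univ E) (hXi ξ)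
        (hXi ξ.derivative) fun e _ t _ => hd e t).continuousAt
    exact ((h1.comp_continuousOn fun t ht => (hγc t ht).continuousWithinAt).div
      (fun t ht => (hyc t ht).continuousWithinAt) hy0).mul
      (hγ.contDiffOn.continuousOn_deriv_of_isOpen isOpen_Ioo le_rfl)
  obtain ⟨I, hI, hBI⟩ := exists_tendsto_integral_of_deriv_eq_mul hQ₁ hBc
    (Complex.exp_ne_zero _) (Complex.exp_ne_zero _) hder
  refine ⟨I, hI, fun Λ hΛ σ hσ x hx => ?_⟩
  -- The branch starts at 0, which is the value of `s` for `Λ₀`; hence `B 0` is the shift factor of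
  -- `Λ₀`.
  have hy00 : y 0 = 0 := by
    have := hγ.branch_sq 0 (by simp)
    rw [hγ.source, hE₀] at this
    simpa using this
  have hB0 : B 0 = σ := by
    have hbU0 : β E₀ ∈ U := by simpa using hbU _ (hβ E₀) 0 (by simp)
    have hne : Λ₀ (β E₀) ≠ 0 := hΛ₀.ne_zero hbU0 (by simpa using hβE E₀ 0 (by simp))
    have h1 := hΛ₀.shift_eq hU (hbU _ (hβ E₀)) (hβE E₀) hbU0
    rw [hσ _ hbU0, mul_comm] at h1
    simp only [hB, hγ.source, hy00]
    exact (mul_left_cancel₀ hne h1).symm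
  have hB1 : B 1 = multiplier τ ξ (β E) E (y 1) := by simp only [hB, hγ.target]
  rw [hΛ.shift_eq hU (hbU _ (hβ E)) (hβE E) hx, ← hB1, hBI, hB0]
  ring

theorem IsLambda.periodic_or_antiperiodic {ξ : XiCoeffs l} (hξ : IsXi τ ξ)
    (hU : IsShiftDomain τ l U) {Λ : ℂ → ℂ} (hΛ : IsLambda τ ξ U E 0 Λ) :
    (∀ x ∈ U, Λ (x + 1) = Λ x) ∨ ∀ x ∈ U, Λ (x + 1) = -Λ x := by
  obtain ⟨a, δ, Ω, K, hδ, -, -, hΩK, hK, hKU, hball⟩ := hU.exists_convex_nhds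
  obtain ⟨b, hb, hbE⟩ :=
    exists_mem_nonvanishingSet hξ hδ hΩK hK (hKU.trans hU.subset) hball E
  have hbU : ∀ t ∈ Set.Icc (0 : ℝ) 1, b + t ∈ U := fun t ht => hKU (hΩK (hball b hb t ht))
  refine (mul_self_eq_one_iff.1 ((sq _).symm.trans (multiplier_zero_sq hU hbU hbE))).imp (fun h x hx => ?_)
    fun h x hx => ?_ <;> simp [hΛ.shift_eq hU hbU hbE hx, h]

end Inozemtsev

end

open Inozemtsev in
theorem corollary3p4 (τ : UpperHalfPlane) (l : Fin 4 → ℕ) (hl : l ≠ 0)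
    (ξ : XiCoeffs l) (hξ : IsXi τ ξ)
    (ε : ℂ) (hε : ∀ t : ℝ, ε + t ∈ regularSet τ l)
    (U : Set ℂ) (hU : IsShiftDomain τ l U)
    (E₀ : ℂ) (hE₀ : Q τ ξ E₀ = 0)
    (Λ₀ : ℂ → ℂ) (hΛ₀ : IsLambda τ ξ U E₀ 0 Λ₀) :
    ((∀ x ∈ U, Λ₀ (x + 1) = Λ₀ x) ∨ (∀ x ∈ U, Λ₀ (x + 1) = -Λ₀ x)) ∧
    ((∀ x ∈ U, Λ₀ (x + 1) = Λ₀ x) →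
      ∀ (E : ℂ) (γ y : ℝ → ℂ), IsBranchedPath τ ξ E₀ E γ y →
        ∃ I : ℂ, HasPathIntegral τ ξ ε γ y I ∧
          ∀ Λ : ℂ → ℂ, IsLambda τ ξ U E (y 1) Λ →
            ∀ x ∈ U, Λ (x + 1) = Λ x * Complex.exp (-(1 / 2) * I)) ∧
    ((∀ x ∈ U, Λ₀ (x + 1) = -Λ₀ x) →
      ∀ (E : ℂ) (γ y : ℝ → ℂ), IsBranchedPath τ ξ E₀ E γ y →
        ∃ I : ℂ, HasPathIntegral τ ξ ε γ y I ∧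
          ∀ Λ : ℂ → ℂ, IsLambda τ ξ U E (y 1) Λ →
            ∀ x ∈ U, Λ (x + 1) = -Λ x * Complex.exp (-(1 / 2) * I)) := by
  refine ⟨hΛ₀.periodic_or_antiperiodic hξ hU, fun h E γ y hγ => ?_, fun h E γ y hγ => ?_⟩
  · obtain ⟨I, hI, hΛ⟩ := exists_pathIntegral hξ hε hU hE₀ hΛ₀ hγ
    exact ⟨I, hI, fun Λ hL x hx => by
      simpa using hΛ Λ hL 1 (fun x hx => by simpa using h x hx) x hx⟩
  · obtain ⟨I, hI, hΛ⟩ := exists_pathIntegral hξ hε hU hE₀ hΛ₀ hγ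
    exact ⟨I, hI, fun Λ hL x hx => by
      simpa using hΛ Λ hL (-1) (fun x hx => by simpa using h x hx) x hx⟩
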